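/- \textbf{Definitions.} A Real simplicial space $(X_\bullet,\rho_\bullet)$ is a simplicial topological space with an involution $\rho_n$ on each $X_n$ commuting with all simplicial maps $\tilde f:X_n\to X_m$, $f\in\mathrm{Hom}_\Delta([m],[n])$. An abelian Real presheaf $(\mathfrak F^\bullet,\sigma^\bullet)$ on it consists of presheaves of abelian groups $\mathfrak F^n$ on $X_n$, restriction maps $\tilde f^*:\mathfrak F^m(V)\to\mathfrak F^n(U)$ whenever $\tilde f(U)\subseteq V$, functorial in $f$ and in the open sets, and involutive isomorphisms $\sigma^n_U:\mathfrak F^n(U)\to\mathfrak F^n(\rho_n(U))$ commuting with all $\tilde f^*$; it is a Real sheaf if every $\mathfrak F^n$ is a sheaf. Morphisms are families of presheaf morphisms $\mathfrak F^n\to\mathfrak G^n$ commuting with all $\tilde f^*$ and $\sigma^n$. A Real open cover $\mathcal U_\bullet$ consists, for every $n\ge 0$, of an open cover $(U^n_j)_{j\in J_n}$ of $X_n$ and an involution $j\mapsto\bar j$ of $J_n$ with $U^n_{\bar j}=\rho_n(U^n_j)$. It is pre-simplicial if increasing maps $f:[m]\to[n]$ act contravariantly by maps $\tilde f:J_n\to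 J_m$ commuting with the involutions with $\tilde f(U^n_j)\subseteq U^m_{\tilde f(j)}$; an $N$-simplicial Real structure on its $N$-skeleton is such an action of all nondecreasing maps between the $[n]$, $n\le N$. A refinement of $\mathcal U_\bullet$ by $\mathcal V_\bullet$ (with index sets $I_n$) is a family of maps $\theta_n:I_n\to J_n$ commuting with the involutions with $V^n_i\subseteq U^n_{\theta_n(i)}$. To $\mathcal U_\bullet$ is associated the pre-simplicial Real cover ${}_\natural\mathcal U_\bullet$ indexed by the families $\lambda$ of elements $\lambda(\varphi)\in J_k$, for all increasing $\varphi:[k]\to[n]$, with $U^n_\lambda=\bigcap_\varphi\tilde\varphi^{-1}(U^k_{\lambda(\varphi)})$, $\bar\lambda(\varphi)=\overline{\lambda(\varphi)}$ and $(\tilde f\lambda)(\varphi)=\lambda(f\circ\varphi)$. Let $CR^n(\mathcal U_\bullet,\mathfrak F^\bullet)$ be the group of families $c_\lambda\in\mathfrak F^n(U^n_\lambda)$ with $c_{\bar\lambda}=\sigma^n(c_\lambda)$ for all $\lambda$, with differential $(dc)_\lambda=\sum_{k=0}^{n+1}(-1)^k\tilde\varepsilon_k^*c_{\tilde\varepsilon_k(\lambda)}$,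 where $\varepsilon_k:[n]\to[n+1]$ is the increasing map avoiding $k$, and let $HR^n(\mathcal U_\bullet,\mathfrak F^\bullet)$ be its $n$-th cohomology group. Let $\mathfrak N(n)$ be the collection of Real open covers whose $N$-skeleton admits an $N$-simplicial Real structure for some $N\ge n+1$, preordered by refinement. Real \v{C}ech cohomology is the direct limit, along the maps induced by refinements, $$\check HR^n(X_\bullet,\mathfrak F^\bullet)=\varinjlim_{\mathcal U_\bullet\in\mathfrak N(n)}HR^n(\mathcal U_\bullet,\mathfrak F^\bullet),$$ and is functorial in $\mathfrak F^\bullet$. \textbf{Proposition.} Let $(X_\bullet,\rho_\bullet)$ be a Real simplicial space such that each $X_n$ is paracompact and Hausdorff, and let $$0\to(\mathfrak F'^\bullet,\sigma'^\bullet)\xrightarrow{\ \phi'_\bullet\ }(\mathfrak F^\bullet,\sigma^\bullet)\xrightarrow{\ \phi_\bullet\ }(\mathfrak F''^\bullet,\sigma''^\bullet)\to0$$ be either an exact sequence of abelian Real sheaves (exact on the stalks at every point of every $X_n$), or an exact sequence of abelian Real presheaves (exact on sections over every open subset of every $X_n$). Then there are homomorphisms $\partial:\check HR^n(X_\bullet,\mathfrak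 F''^\bullet)\to\check HR^{n+1}(X_\bullet,\mathfrak F'^\bullet)$, $n\ge0$, such that the sequence of abelian groups $$0\to\check HR^0(X_\bullet,\mathfrak F'^\bullet)\xrightarrow{\phi'_*}\check HR^0(X_\bullet,\mathfrak F^\bullet)\xrightarrow{\phi_*}\check HR^0(X_\bullet,\mathfrak F''^\bullet)\xrightarrow{\ \partial\ }\check HR^1(X_\bullet,\mathfrak F'^\bullet)\xrightarrow{\phi'_*}\cdots$$ is exact. Here $\partial$ is the connecting homomorphism: if $\mathcal U_\bullet\in\mathfrak N(n)\cap\mathfrak N(n+1)$, $c\in CR^n(\mathcal U_\bullet,\mathfrak F^\bullet)$, and $z''$, $z'$ are Real cocycles relative to $\mathcal U_\bullet$ with values in $\mathfrak F''^\bullet$, $\mathfrak F'^\bullet$, of degrees $n$, $n+1$, such that $\phi(c)=z''$ and $\phi'(z')=dc$, then $\partial[z'']=[z']$. -/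

import Mathlib

open CategoryTheory TopologicalSpace Opposite
open scoped Simplicial

universe u

noncomputable section

namespace RealCech

/-! ### Real simplicial spaces -/

/-- A Real simplicial space: a simplicial topological space with an involutive automorphism `ρ`
(equivalently, a contravariant functor from the simplex category to the category of topological
spaces with involution and equivariant continuous maps). -/
structure RealSimplicialSpace : Type (u + 1) where
  X : SimplicialObject TopCat.{u}
  ρ : X ⟶ X
  ρ_ρ : ρ ≫ ρ = 𝟙 X

namespace RealSimplicialSpace

variable (X : RealSimplicialSpace.{u})

/-- The space `X_n`. -/
abbrev space (n : ℕ) : TopCat.{u} := X.X.obj (op ⦋n⦌)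

/-- The map `f̃ : X_n ⟶ X_m` of a nondecreasing `f : [m] ⟶ [n]`. -/
abbrev face {m n : ℕ} (f : ⦋m⦌ ⟶ ⦋n⦌) : X.space n ⟶ X.space m := X.X.map f.op

/-- The involution of `X_n`. -/
abbrev inv (n : ℕ) : X.space n ⟶ X.space n := X.ρ.app (op ⦋n⦌)

/-- `f̃⁻¹(V)`. -/
abbrev preim {m n : ℕ} (f : ⦋m⦌ ⟶ ⦋n⦌) (V : Opens (X.space m)) : Opens (X.space n) :=
  (Opens.map (X.face f)).obj V

/-- `ρ_n(U)`, which is `ρ_n⁻¹(U)` since `ρ_n` is an involution. -/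
abbrev conj {n : ℕ} (U : Opens (X.space n)) : Opens (X.space n) :=
  (Opens.map (X.inv n)).obj U

end RealSimplicialSpace

/-! ### Abelian Real presheaves and sheaves on a Real simplicial space -/

/-- An abelian Real presheaf on a Real simplicial space: abelian presheaves `𝔉ⁿ` on the `X_n`,
functorial restriction maps `f̃* : 𝔉ᵐ(V) ⟶ 𝔉ⁿ(U)` for `f : [m] ⟶ [n]` and `f̃(U) ⊆ V`
(these are the `f̃`-morphisms `𝔉ᵐ ⟶ f̃_* 𝔉ⁿ`; for `f = id` they are the restrictions of `𝔉ⁿ`),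
and an involution `σ_U : 𝔉ⁿ(U) ⟶ 𝔉ⁿ(ρ(U))` compatible with all restriction maps. -/
structure RealPresheaf (X : RealSimplicialSpace.{u}) : Type (u + 1) where
  sec : ∀ n : ℕ, (X.space n).Presheaf AddCommGrpCat.{u}
  pull : ∀ {m n : ℕ} (f : ⦋m⦌ ⟶ ⦋n⦌) (V : Opens (X.space m)) (U : Opens (X.space n)),
    U ≤ X.preim f V → ((sec m).obj (op V) ⟶ (sec n).obj (op U))
  pull_id : ∀ {n : ℕ} (V U : Opens (X.space n)) (h : U ≤ X.preim (𝟙 ⦋n⦌) V) (h' : U ≤ V),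
    pull (𝟙 ⦋n⦌) V U h = (sec n).map (homOfLE h').op
  pull_comp : ∀ {k m n : ℕ} (g : ⦋k⦌ ⟶ ⦋m⦌) (f : ⦋m⦌ ⟶ ⦋n⦌) (W : Opens (X.space k))
    (V : Opens (X.space m)) (U : Opens (X.space n)) (hg : V ≤ X.preim g W)
    (hf : U ≤ X.preim f V) (hfg : U ≤ X.preim (g ≫ f) W),
    pull g W V hg ≫ pull f V U hf = pull (g ≫ f) W U hfg
  σ : ∀ (n : ℕ) (U U' : Opens (X.space n)), U' = X.conj U →
    ((sec n).obj (op U) ⟶ (sec n).obj (op U'))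
  σ_σ : ∀ (n : ℕ) (U U' : Opens (X.space n)) (h : U' = X.conj U) (h' : U = X.conj U'),
    σ n U U' h ≫ σ n U' U h' = 𝟙 _
  σ_pull : ∀ {m n : ℕ} (f : ⦋m⦌ ⟶ ⦋n⦌) (V V' : Opens (X.space m)) (U U' : Opens (X.space n))
    (hV : V' = X.conj V) (hU : U' = X.conj U) (h : U ≤ X.preim f V) (h' : U' ≤ X.preim f V'),
    pull f V U h ≫ σ n U U' hU = σ m V V' hV ≫ pull f V' U' h'

/-- A Real sheaf is a Real presheaf whose underlying presheaf on each `X_n` is a sheaf. -/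
def RealPresheaf.IsRealSheaf {X : RealSimplicialSpace.{u}} (F : RealPresheaf X) : Prop :=
  ∀ n, (F.sec n).IsSheaf

/-- Morphisms of abelian Real (pre)sheaves on a Real simplicial space. -/
structure RealPresheaf.Hom {X : RealSimplicialSpace.{u}} (F G : RealPresheaf X) where
  app : ∀ n, F.sec n ⟶ G.sec n
  pull_app : ∀ {m n : ℕ} (f : ⦋m⦌ ⟶ ⦋n⦌) (V : Opens (X.space m)) (U : Opens (X.space n))
    (h : U ≤ X.preim f V),
    F.pull f V U h ≫ (app n).app (op U) = (app m).app (op V) ≫ G.pull f V U h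
  σ_app : ∀ (n : ℕ) (U U' : Opens (X.space n)) (h : U' = X.conj U),
    F.σ n U U' h ≫ (app n).app (op U') = (app n).app (op U) ≫ G.σ n U U' h

/-- Exactness of `0 ⟶ F' ⟶ F ⟶ F'' ⟶ 0` as a sequence of presheaves: exactness on sections over
every open set of every `X_n`. -/
def PresheafShortExact {X : RealSimplicialSpace.{u}} {F' F F'' : RealPresheaf X}
    (φ' : F'.Hom F) (φ : F.Hom F'') : Prop :=
  ∀ (n : ℕ) (U : Opens (X.space n)),
    Function.Injective ((φ'.app n).app (op U)) ∧
    Function.Exact ((φ'.app n).app (op U)) ((φ.app n).app (op U)) ∧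
    Function.Surjective ((φ.app n).app (op U))

/-- Exactness of `0 ⟶ F' ⟶ F ⟶ F'' ⟶ 0` as a sequence of sheaves: exactness on the stalks at
every point of every `X_n`. -/
def SheafShortExact {X : RealSimplicialSpace.{u}} {F' F F'' : RealPresheaf X}
    (φ' : F'.Hom F) (φ : F.Hom F'') : Prop :=
  ∀ (n : ℕ) (x : X.space n),
    Function.Injective ((TopCat.Presheaf.stalkFunctor AddCommGrpCat.{u} x).map (φ'.app n)) ∧
    Function.Exact ((TopCat.Presheaf.stalkFunctor AddCommGrpCat.{u} x).map (φ'.app n))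
      ((TopCat.Presheaf.stalkFunctor AddCommGrpCat.{u} x).map (φ.app n)) ∧
    Function.Surjective ((TopCat.Presheaf.stalkFunctor AddCommGrpCat.{u} x).map (φ.app n))

/-! ### Real open covers -/

/-- A Real open cover of a Real simplicial space: for each `n` an open cover of `X_n` indexed by
a set `J_n` with an involution `j ↦ j̄` such that `U_{j̄} = ρ_n(U_j)`. -/
structure RealCover (X : RealSimplicialSpace.{u}) : Type (u + 1) where
  J : ℕ → Type u
  bar : ∀ n, J n → J n
  bar_bar : ∀ n j, bar n (bar n j) = j
  U : ∀ n, J n → Opens (X.space n)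
  U_bar : ∀ n j, U n (bar n j) = X.conj (U n j)
  covers : ∀ n (x : X.space n), ∃ j, x ∈ U n j

/-- Increasing maps `[k] ⟶ [n]`, the morphisms of the pre-simplicial category. -/
abbrev Inc (k n : ℕ) : Type := {φ : ⦋k⦌ ⟶ ⦋n⦌ // StrictMono φ.toOrderHom}

/-- The identity of `[n]`, as an increasing map. -/
def Inc.id (n : ℕ) : Inc n n := ⟨𝟙 _, fun _ _ h => h⟩

/-- Composition `[k] ⟶ [m] ⟶ [n]` of increasing maps. -/
def Inc.comp {k m n : ℕ} (f : Inc m n) (φ : Inc k m) : Inc k n :=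
  ⟨φ.1 ≫ f.1, fun _ _ h => f.2 (φ.2 h)⟩

/-- The increasing map `ε_i : [n] ⟶ [n + 1]` that avoids `i`. -/
def Inc.ε {n : ℕ} (i : Fin (n + 2)) : Inc n (n + 1) :=
  ⟨SimplexCategory.δ i, Fin.strictMono_succAbove i⟩

/-- A pre-simplicial Real open cover: the index sets form a Real pre-simplicial set and
`f̃(U_j) ⊆ U_{f̃(j)}`. -/
structure PreSimplicialCover (X : RealSimplicialSpace.{u}) : Type (u + 1) extends
    RealCover X where
  map : ∀ {m n : ℕ}, Inc m n → J n → J m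
  map_id : ∀ n j, map (Inc.id n) j = j
  map_comp : ∀ {k m n : ℕ} (f : Inc m n) (g : Inc k m) (j : J n),
    map (f.comp g) j = map g (map f j)
  map_bar : ∀ {m n : ℕ} (f : Inc m n) (j : J n), map f (bar n j) = bar m (map f j)
  le_map : ∀ {m n : ℕ} (f : Inc m n) (j : J n), U n j ≤ X.preim f.1 (U m (map f j))

/-- An `N`-simplicial Real structure on the `N`-skeleton of a Real open cover: the index sets
`J_n`, `n ≤ N`, form a Real `N`-simplicial set and `f̃(U_j) ⊆ U_{f̃(j)}`. -/
structure NSimplicialStructure {X : RealSimplicialSpace.{u}} (𝒰 : RealCover X) (N : ℕ) where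
  map : ∀ {m n : ℕ}, m ≤ N → n ≤ N → (⦋m⦌ ⟶ ⦋n⦌) → 𝒰.J n → 𝒰.J m
  map_id : ∀ {n : ℕ} (hn : n ≤ N) (j : 𝒰.J n), map hn hn (𝟙 ⦋n⦌) j = j
  map_comp : ∀ {k m n : ℕ} (hk : k ≤ N) (hm : m ≤ N) (hn : n ≤ N) (g : ⦋k⦌ ⟶ ⦋m⦌)
    (f : ⦋m⦌ ⟶ ⦋n⦌) (j : 𝒰.J n), map hk hn (g ≫ f) j = map hk hm g (map hm hn f j)
  map_bar : ∀ {m n : ℕ} (hm : m ≤ N) (hn : n ≤ N) (f : ⦋m⦌ ⟶ ⦋n⦌) (j : 𝒰.J n),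
    map hm hn f (𝒰.bar n j) = 𝒰.bar m (map hm hn f j)
  le_map : ∀ {m n : ℕ} (hm : m ≤ N) (hn : n ≤ N) (f : ⦋m⦌ ⟶ ⦋n⦌) (j : 𝒰.J n),
    𝒰.U n j ≤ X.preim f (𝒰.U m (map hm hn f j))

variable {X : RealSimplicialSpace.{u}}

lemma Inc.le {k n : ℕ} (φ : Inc k n) : k ≤ n := by
  have h := Fintype.card_le_of_injective _ φ.2.injective
  simpa using h

instance (n : ℕ) : Finite (Σ k : ℕ, Inc k n) :=
  Finite.of_injective
    (fun p : (Σ k : ℕ, Inc k n) => (⟨⟨p.1, Nat.lt_succ_of_le p.2.le⟩, p.2⟩ :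
      Σ k : Fin (n + 1), Inc k n)) (by
    rintro ⟨k, φ⟩ ⟨l, ψ⟩ h
    simp only [Sigma.mk.injEq, Fin.mk.injEq] at h
    obtain ⟨rfl, h⟩ := h
    simp only [heq_eq_eq] at h
    rw [h])

/-- The index set `Λ_n` of the associated pre-simplicial cover: families `λ(φ) ∈ J_k`, indexed by
the increasing maps `φ : [k] ⟶ [n]`. -/
abbrev RealCover.Λ (𝒰 : RealCover X) (n : ℕ) : Type u := ∀ k : ℕ, Inc k n → 𝒰.J k

/-- `U_λ = ⋂_φ φ̃⁻¹(U_{λ(φ)})`. -/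
def RealCover.natU (𝒰 : RealCover X) (n : ℕ) (l : 𝒰.Λ n) : Opens (X.space n) where
  carrier := {x | ∀ (k : ℕ) (φ : Inc k n), X.face φ.1 x ∈ 𝒰.U k (l k φ)}
  is_open' := by
    have h : {x | ∀ (k : ℕ) (φ : Inc k n), X.face φ.1 x ∈ 𝒰.U k (l k φ)} =
        ⋂ p : (Σ k : ℕ, Inc k n), (X.face p.2.1) ⁻¹' (𝒰.U p.1 (l p.1 p.2) : Set _) := by
      ext x
      simp [Sigma.forall]
    rw [h]
    exact isOpen_iInter_of_finite fun p =>
      (𝒰.U p.1 (l p.1 p.2)).isOpen.preimage (X.face p.2.1).hom.continuous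

lemma RealCover.mem_natU (𝒰 : RealCover X) (n : ℕ) (l : 𝒰.Λ n) (x : X.space n) :
    x ∈ 𝒰.natU n l ↔ ∀ (k : ℕ) (φ : Inc k n), X.face φ.1 x ∈ 𝒰.U k (l k φ) := Iff.rfl

lemma RealSimplicialSpace.face_inv (X : RealSimplicialSpace.{u}) {m n : ℕ} (f : ⦋m⦌ ⟶ ⦋n⦌)
    (x : X.space n) : X.face f (X.inv n x) = X.inv m (X.face f x) := by
  have h := X.ρ.naturality f.op
  exact (ConcreteCategory.congr_hom h x).symm

lemma RealSimplicialSpace.preim_id (X : RealSimplicialSpace.{u}) {n : ℕ} (V : Opens (X.space n)) :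
    X.preim (𝟙 ⦋n⦌) V = V := by
  ext x
  have h : X.face (𝟙 ⦋n⦌) x = x := ConcreteCategory.congr_hom (X.X.map_id (op ⦋n⦌)) x
  change X.face (𝟙 ⦋n⦌) x ∈ V ↔ x ∈ V
  rw [h]

lemma RealSimplicialSpace.face_comp (X : RealSimplicialSpace.{u}) {k m n : ℕ} (g : ⦋k⦌ ⟶ ⦋m⦌)
    (f : ⦋m⦌ ⟶ ⦋n⦌) (x : X.space n) : X.face (g ≫ f) x = X.face g (X.face f x) := by
  have h := X.X.map_comp f.op g.op
  exact ConcreteCategory.congr_hom h x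

/-- The pre-simplicial Real open cover `♮𝒰` associated with a Real open cover `𝒰`. -/
def RealCover.nat (𝒰 : RealCover X) : PreSimplicialCover X where
  J n := 𝒰.Λ n
  bar _ l := fun k φ => 𝒰.bar k (l k φ)
  bar_bar n l := by
    funext k φ
    exact 𝒰.bar_bar k _
  U := 𝒰.natU
  U_bar n l := by
    ext x
    change (∀ (k : ℕ) (φ : Inc k n), X.face φ.1 x ∈ 𝒰.U k (𝒰.bar k (l k φ))) ↔
      ∀ (k : ℕ) (φ : Inc k n), X.face φ.1 (X.inv n x) ∈ 𝒰.U k (l k φ)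
    refine forall_congr' fun k => forall_congr' fun φ => ?_
    rw [𝒰.U_bar, X.face_inv]
    rfl
  covers n x := by
    choose j hj using fun (k : ℕ) (φ : Inc k n) => 𝒰.covers k (X.face φ.1 x)
    exact ⟨j, hj⟩
  map f l := fun k φ => l k (f.comp φ)
  map_id n l := by
    funext k φ
    exact congrArg (l k) (Subtype.ext (Category.comp_id φ.1))
  map_comp f g l := by
    funext k φ
    exact congrArg (l k) (Subtype.ext (Category.assoc φ.1 g.1 f.1).symm)
  map_bar _ _ := rfl
  le_map {m n} f l x hx := by
    intro k φ
    have h := hx k (f.comp φ)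
    have e : X.face (f.comp φ).1 x = X.face φ.1 (X.face f.1 x) := X.face_comp φ.1 f.1 x
    rw [e] at h
    exact h

/-! ### Cochains -/

section cochains

variable (𝒱 : PreSimplicialCover X) (F : RealPresheaf X)

/-- The group `CR_ss^n(𝒱, F)` of globally Real families of local sections of `𝔉ⁿ` over `𝒱_n`. -/
def cochain (n : ℕ) : AddSubgroup (∀ j : 𝒱.J n, (F.sec n).obj (op (𝒱.U n j))) where
  carrier := {s | ∀ j, s (𝒱.bar n j) =
    F.σ n (𝒱.U n j) (𝒱.U n (𝒱.bar n j)) (𝒱.U_bar n j) (s j)}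
  add_mem' {s t} hs ht j := by
    simp only [Pi.add_apply, map_add]
    rw [hs j, ht j]
  zero_mem' j := by simp
  neg_mem' {s} hs j := by
    simp only [Pi.neg_apply, map_neg]
    rw [hs j]

/-- The `i`-th term `c ↦ (ε̃_i^* c_{ε̃_i(j)})_j` of the differential. -/
def coface {n : ℕ} (i : Fin (n + 2)) : cochain 𝒱 F n →+ cochain 𝒱 F (n + 1) where
  toFun c := ⟨fun j => F.pull (Inc.ε i).1 (𝒱.U n (𝒱.map (Inc.ε i) j)) (𝒱.U (n + 1) j)
      (𝒱.le_map (Inc.ε i) j) (c.1 (𝒱.map (Inc.ε i) j)), fun j => by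
    have key : ∀ (a : 𝒱.J n) (ha : a = 𝒱.bar n (𝒱.map (Inc.ε i) j))
        (h : 𝒱.U (n + 1) (𝒱.bar (n + 1) j) ≤ X.preim (Inc.ε i).1 (𝒱.U n a)),
        F.pull (Inc.ε i).1 (𝒱.U n a) (𝒱.U (n + 1) (𝒱.bar (n + 1) j)) h (c.1 a) =
        F.σ (n + 1) (𝒱.U (n + 1) j) (𝒱.U (n + 1) (𝒱.bar (n + 1) j)) (𝒱.U_bar (n + 1) j)
          (F.pull (Inc.ε i).1 (𝒱.U n (𝒱.map (Inc.ε i) j)) (𝒱.U (n + 1) j)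
            (𝒱.le_map (Inc.ε i) j) (c.1 (𝒱.map (Inc.ε i) j))) := by
      rintro a rfl h
      rw [c.2 (𝒱.map (Inc.ε i) j)]
      exact (ConcreteCategory.congr_hom (F.σ_pull (Inc.ε i).1 _ _ _ _
        (𝒱.U_bar n (𝒱.map (Inc.ε i) j)) (𝒱.U_bar (n + 1) j)
        (𝒱.le_map (Inc.ε i) j) h) (c.1 (𝒱.map (Inc.ε i) j))).symm
    exact key _ (𝒱.map_bar _ _) _⟩
  map_zero' := by
    apply Subtype.ext
    funext j
    simp
  map_add' c c' := by
    apply Subtype.ext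
    funext j
    simp

/-- The differential `(dc)_j = ∑_i (-1)^i ε̃_i^* c_{ε̃_i(j)}`. -/
def d (n : ℕ) : cochain 𝒱 F n →+ cochain 𝒱 F (n + 1) :=
  ∑ i : Fin (n + 2), ((-1 : ℤ) ^ (i : ℕ)) • coface 𝒱 F i

lemma d_apply (n : ℕ) (c : cochain 𝒱 F n) :
    d 𝒱 F n c = ∑ i : Fin (n + 2), ((-1 : ℤ) ^ (i : ℕ)) • coface 𝒱 F i c := by
  simp [d]

lemma d_d (n : ℕ)
    (c : cochain 𝒱 F n) : d 𝒱 F (n+1) (d 𝒱 F n c) = 0 := by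
  have key : ∀ (i j : Fin (n+2)) , i ≤ j →
     coface 𝒱 F j.succ (coface 𝒱 F i c) = coface 𝒱 F i.castSucc (coface 𝒱 F j c) := by
    intro i j hij
    apply Subtype.ext
    funext l
    have hm : ∀ (a b : Inc n (n+1)) (a' b' : Inc (n+1) (n+2)), a'.comp a = b'.comp b →
       F.pull a'.1 _ _ (𝒱.le_map a' l) (F.pull a.1 _ _ (𝒱.le_map a (𝒱.map a' l)) (c.1 (𝒱.map a (𝒱.map a' l)))) =
       F.pull b'.1 _ _ (𝒱.le_map b' l) (F.pull b.1 _ _ (𝒱.le_map b (𝒱.map b' l)) (c.1 (𝒱.map b (𝒱.map b' l)))) := by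
      have one : ∀ (e : Inc n (n+2)) (a : Inc n (n+1)) (a' : Inc (n+1) (n+2)) (he : a'.comp a = e),
         F.pull a'.1 _ _ (𝒱.le_map a' l) (F.pull a.1 _ _ (𝒱.le_map a (𝒱.map a' l)) (c.1 (𝒱.map a (𝒱.map a' l)))) = F.pull e.1 _ _ (𝒱.le_map e l) (c.1 (𝒱.map e l)) := by
        rintro _ a a' rfl
        have h := 𝒱.map_comp a' a l
        have gen : ∀ (x y : 𝒱.J n) (hxy : x = y) (hx : 𝒱.U (n+1) (𝒱.map a' l) ≤ X.preim a.1 (𝒱.U n x)) (hy : 𝒱.U (n+2) l ≤ X.preim (a'.comp a).1 (𝒱.U n y)),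
          F.pull a'.1 _ _ (𝒱.le_map a' l) (F.pull a.1 _ _ hx (c.1 x)) = F.pull (a'.comp a).1 _ _ hy (c.1 y) := by
          rintro x _ rfl hx hy
          exact ConcreteCategory.congr_hom (F.pull_comp a.1 a'.1 _ _ _ hx (𝒱.le_map a' l) hy) (c.1 x)
        exact gen _ _ h.symm _ _
      intro a b a' b' h
      rw [one _ a a' rfl, one _ b b' h.symm]
    exact hm (Inc.ε i) (Inc.ε j) (Inc.ε j.succ) (Inc.ε i.castSucc) (Subtype.ext (SimplexCategory.δ_comp_δ hij))
  simp only [d_apply, map_sum, map_zsmul, Finset.smul_sum, smul_smul, ← pow_add]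
  rw [Finset.sum_comm, ← Finset.sum_product', Finset.univ_product_univ, ← Finset.sum_add_sum_compl (Finset.univ.filter fun p : Fin (n+3) × Fin (n+2) => (p.2 : ℕ) < p.1), add_eq_zero_iff_eq_neg, ← Finset.sum_neg_distrib]
  refine Finset.sum_bij (fun p hp => (p.2.castSucc, p.1.pred (by rintro h; simp [h] at hp))) ?_ ?_ ?_ ?_
  · rintro ⟨a, b⟩ h
    simp at h ⊢
    omega
  · rintro ⟨a, b⟩ h ⟨a', b'⟩ h' e
    simp [Fin.ext_iff] at e h h' ⊢
    omega
  · rintro ⟨a, b⟩ h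
    simp at h
    refine ⟨(b.succ, a.castPred (by rintro rfl; simp at h; omega)), ?_, ?_⟩
    · simp; omega
    · simp
  · rintro ⟨a, b⟩ h
    simp at h
    obtain ⟨a, rfl⟩ := Fin.exists_succ_eq.2 (show a ≠ 0 by rintro rfl; simp at h)
    simp only [Fin.pred_succ, Fin.val_castSucc, Fin.val_succ]
    rw [key b a (by rw [Fin.le_def]; simp at h; omega), ← neg_smul]
    congr 1
    ring

/-- The group `ZR_ss^n` of Real `n`-cocycles. -/
abbrev cocycle (n : ℕ) : AddSubgroup (cochain 𝒱 F n) := (d 𝒱 F n).ker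

/-- The group `BR_ss^n` of Real `n`-coboundaries. -/
def coboundary (n : ℕ) : AddSubgroup (cochain 𝒱 F n) :=
  match n with
  | 0 => ⊥
  | n + 1 => (d 𝒱 F n).range

/-- `HR_ss^n(𝒱, F) = ZR_ss^n / BR_ss^n`. -/
abbrev HRss (n : ℕ) : Type u :=
  cocycle 𝒱 F n ⧸ (coboundary 𝒱 F n).addSubgroupOf (cocycle 𝒱 F n)

end cochains

/-- A homomorphism induced on `HR_ss^*` by a morphism of cochain complexes. -/
def HRss.map {𝒱 𝒲 : PreSimplicialCover X} {F G : RealPresheaf X}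
    (t : ∀ n, cochain 𝒱 F n →+ cochain 𝒲 G n)
    (ht : ∀ n c, d 𝒲 G n (t n c) = t (n + 1) (d 𝒱 F n c)) (n : ℕ) :
    HRss 𝒱 F n →+ HRss 𝒲 G n :=
  QuotientAddGroup.map _ _
    (((t n).comp (cocycle 𝒱 F n).subtype).codRestrict (cocycle 𝒲 G n) (fun c => by
      have hc : d 𝒱 F n c.1 = 0 := c.2
      change d 𝒲 G n (t n c.1) = 0
      rw [ht, hc, map_zero]))
    (by
      intro c hc
      cases n with
      | zero =>
        have hc : c.1 = 0 := hc
        change t 0 c.1 = 0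
        rw [hc, map_zero]
      | succ n =>
        obtain ⟨b, hb⟩ : c.1 ∈ (d 𝒱 F n).range := hc
        exact ⟨t n b, by rw [ht, hb]; rfl⟩)

/-! ### Refinements -/

/-- A refinement `θ : 𝒱 ⟶ 𝒰`, exhibiting `𝒱` as finer than `𝒰`. -/
structure Refinement (𝒰 𝒱 : RealCover X) where
  θ : ∀ n, 𝒱.J n → 𝒰.J n
  θ_bar : ∀ n i, θ n (𝒱.bar n i) = 𝒰.bar n (θ n i)
  le : ∀ n i, 𝒱.U n i ≤ 𝒰.U n (θ n i)

/-- A pre-simplicial refinement of pre-simplicial Real open covers. -/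
structure PreSimplicialRefinement (𝒰 𝒱 : PreSimplicialCover X) extends
    Refinement 𝒰.toRealCover 𝒱.toRealCover where
  θ_map : ∀ {m n : ℕ} (f : Inc m n) (i : 𝒱.J n), θ m (𝒱.map f i) = 𝒰.map f (θ n i)

/-- A refinement `θ` induces the pre-simplicial refinement `λ ↦ θ ∘ λ` of the associated
pre-simplicial covers. -/
def Refinement.nat {𝒰 𝒱 : RealCover X} (r : Refinement 𝒰 𝒱) :
    PreSimplicialRefinement 𝒰.nat 𝒱.nat where
  θ n (l : 𝒱.Λ n) := fun k φ => r.θ k (l k φ)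
  θ_bar n (l : 𝒱.Λ n) := by
    funext k φ
    exact r.θ_bar k (l k φ)
  le n (l : 𝒱.Λ n) := fun x (hx : x ∈ 𝒱.natU n l) k φ => r.le k (l k φ) (hx k φ)
  θ_map _ _ := rfl

/-- `(θ^* c)_i` is the restriction of `c_{θ(i)}` to `V_i`. -/
def PreSimplicialRefinement.cochainMap {𝒰 𝒱 : PreSimplicialCover X}
    (r : PreSimplicialRefinement 𝒰 𝒱) (F : RealPresheaf X) (n : ℕ) :
    cochain 𝒰 F n →+ cochain 𝒱 F n where
  toFun c := ⟨fun i => (F.sec n).map (homOfLE (r.le n i)).op (c.1 (r.θ n i)), fun i => by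
    have key : ∀ (a : 𝒰.J n) (ha : a = 𝒰.bar n (r.θ n i))
        (h : 𝒱.U n (𝒱.bar n i) ≤ 𝒰.U n a),
        (F.sec n).map (homOfLE h).op (c.1 a) =
        F.σ n (𝒱.U n i) (𝒱.U n (𝒱.bar n i)) (𝒱.U_bar n i)
          ((F.sec n).map (homOfLE (r.le n i)).op (c.1 (r.θ n i))) := by
      rintro a rfl h
      rw [c.2 (r.θ n i)]
      have h₁ := F.σ_pull (𝟙 ⦋n⦌) _ _ _ _ (𝒰.U_bar n (r.θ n i)) (𝒱.U_bar n i)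
        (by rw [X.preim_id]; exact r.le n i) (by rw [X.preim_id]; exact h)
      rw [F.pull_id _ _ _ (r.le n i), F.pull_id _ _ _ h] at h₁
      exact (ConcreteCategory.congr_hom h₁ (c.1 (r.θ n i))).symm
    exact key _ (r.θ_bar n i) _⟩
  map_zero' := by
    apply Subtype.ext
    funext j
    simp
  map_add' c c' := by
    apply Subtype.ext
    funext j
    simp

lemma PreSimplicialRefinement.d_cochainMap {𝒰 𝒱 : PreSimplicialCover X}
    (r : PreSimplicialRefinement 𝒰 𝒱) (F : RealPresheaf X) (n : ℕ) (c : cochain 𝒰 F n) :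
    d 𝒱 F n (r.cochainMap F n c) = r.cochainMap F (n + 1) (d 𝒰 F n c) := by
  rw [d_apply, d_apply, map_sum]
  refine Finset.sum_congr rfl fun i _ => ?_
  rw [map_zsmul]
  congr 1
  apply Subtype.ext
  funext j
  have key : ∀ (a : 𝒰.J n) (ha : a = 𝒰.map (Inc.ε i) (r.θ (n + 1) j))
      (h : 𝒱.U n (𝒱.map (Inc.ε i) j) ≤ 𝒰.U n a),
      F.pull (Inc.ε i).1 (𝒱.U n (𝒱.map (Inc.ε i) j)) (𝒱.U (n + 1) j) (𝒱.le_map (Inc.ε i) j)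
        ((F.sec n).map (homOfLE h).op (c.1 a)) =
      (F.sec (n + 1)).map (homOfLE (r.le (n + 1) j)).op
        (F.pull (Inc.ε i).1 (𝒰.U n (𝒰.map (Inc.ε i) (r.θ (n + 1) j)))
          (𝒰.U (n + 1) (r.θ (n + 1) j)) (𝒰.le_map (Inc.ε i) (r.θ (n + 1) j))
          (c.1 (𝒰.map (Inc.ε i) (r.θ (n + 1) j)))) := by
    rintro a rfl h
    have hle : 𝒱.U (n + 1) j ≤
        X.preim (Inc.ε i).1 (𝒰.U n (𝒰.map (Inc.ε i) (r.θ (n + 1) j))) :=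
      le_trans (r.le (n + 1) j) (𝒰.le_map (Inc.ε i) (r.θ (n + 1) j))
    have h₁ := F.pull_comp (𝟙 ⦋n⦌) (Inc.ε i).1 (𝒰.U n (𝒰.map (Inc.ε i) (r.θ (n + 1) j)))
      (𝒱.U n (𝒱.map (Inc.ε i) j)) (𝒱.U (n + 1) j) (by rw [X.preim_id]; exact h)
      (𝒱.le_map (Inc.ε i) j) (by rw [Category.id_comp]; exact hle)
    have h₂ := F.pull_comp (Inc.ε i).1 (𝟙 ⦋n + 1⦌)
      (𝒰.U n (𝒰.map (Inc.ε i) (r.θ (n + 1) j))) (𝒰.U (n + 1) (r.θ (n + 1) j))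
      (𝒱.U (n + 1) j) (𝒰.le_map (Inc.ε i) (r.θ (n + 1) j))
      (by rw [X.preim_id]; exact r.le (n + 1) j) (by rw [Category.comp_id]; exact hle)
    rw [F.pull_id _ _ _ h] at h₁
    rw [F.pull_id _ _ _ (r.le (n + 1) j)] at h₂
    have h₃ := ConcreteCategory.congr_hom h₁ (c.1 (𝒰.map (Inc.ε i) (r.θ (n + 1) j)))
    have h₄ := ConcreteCategory.congr_hom h₂ (c.1 (𝒰.map (Inc.ε i) (r.θ (n + 1) j)))
    simp only [Category.id_comp] at h₃
    simp only [Category.comp_id] at h₄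
    exact h₃.trans h₄.symm
  exact key _ (r.θ_map _ _) _

/-! ### Cohomology of a cover -/

/-- `HR^n(𝒰, F) = HR_ss^n(♮𝒰, F)`. -/
abbrev HR (𝒰 : RealCover X) (F : RealPresheaf X) (n : ℕ) : Type u := HRss 𝒰.nat F n

/-- The homomorphism `θ^* : HR^n(𝒰, F) ⟶ HR^n(𝒱, F)` induced by a refinement. -/
def HR.refine {𝒰 𝒱 : RealCover X} (r : Refinement 𝒰 𝒱) (F : RealPresheaf X) (n : ℕ) :
    HR 𝒰 F n →+ HR 𝒱 F n :=
  HRss.map (r.nat.cochainMap F) (r.nat.d_cochainMap F) n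

/-- The homomorphism `(c_j)_j ↦ (φ(c_j))_j` of cochain groups induced by a morphism `φ`. -/
def RealPresheaf.Hom.cochainMap {F G : RealPresheaf X} (φ : F.Hom G) (𝒱 : PreSimplicialCover X)
    (n : ℕ) : cochain 𝒱 F n →+ cochain 𝒱 G n where
  toFun c := ⟨fun j => (φ.app n).app (op (𝒱.U n j)) (c.1 j), fun j => by
    beta_reduce
    rw [c.2 j]
    exact ConcreteCategory.congr_hom (φ.σ_app n _ _ (𝒱.U_bar n j)) (c.1 j)⟩
  map_zero' := by
    apply Subtype.ext
    funext j
    simp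
  map_add' c c' := by
    apply Subtype.ext
    funext j
    simp

lemma RealPresheaf.Hom.d_cochainMap {F G : RealPresheaf X} (φ : F.Hom G)
    (𝒱 : PreSimplicialCover X) (n : ℕ) (c : cochain 𝒱 F n) :
    d 𝒱 G n (φ.cochainMap 𝒱 n c) = φ.cochainMap 𝒱 (n + 1) (d 𝒱 F n c) := by
  rw [d_apply, d_apply, map_sum]
  refine Finset.sum_congr rfl fun i _ => ?_
  rw [map_zsmul]
  congr 1
  apply Subtype.ext
  funext j
  exact (ConcreteCategory.congr_hom (φ.pull_app (Inc.ε i).1 _ _ (𝒱.le_map (Inc.ε i) j))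
    (c.1 (𝒱.map (Inc.ε i) j))).symm

/-- The homomorphism `φ_* : HR^n(𝒰, F) ⟶ HR^n(𝒰, G)` induced by a morphism `φ`. -/
def RealPresheaf.Hom.mapHR {F G : RealPresheaf X} (φ : F.Hom G) (𝒰 : RealCover X) (n : ℕ) :
    HR 𝒰 F n →+ HR 𝒰 G n :=
  HRss.map (φ.cochainMap 𝒰.nat) (φ.d_cochainMap 𝒰.nat) n

/-! ### Real Čech cohomology -/

/-- A Real open cover belongs to `𝔑(n)` if for some `N ≥ n + 1` its `N`-skeleton admits an
`N`-simplicial Real structure. -/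
def RealCover.IsAdmissible (𝒰 : RealCover X) (n : ℕ) : Prop :=
  ∃ N, n + 1 ≤ N ∧ Nonempty (NSimplicialStructure 𝒰 N)

variable (X) in
/-- The collection `𝔑(n)`. -/
structure CoverSystem (n : ℕ) : Type (u + 1) where
  cover : RealCover X
  admissible : cover.IsAdmissible n

/-- `𝔑(n)` is preordered by refinement (the relation `𝒰 ≼ 𝒱` means that `𝒱` is finer than `𝒰`;
that a skeleton of `𝒱` has a simplicial structure is automatic in `𝔑(n)`). -/
instance (n : ℕ) : Preorder (CoverSystem X n) where
  le 𝒰 𝒱 := Nonempty (Refinement 𝒰.cover 𝒱.cover)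
  le_refl 𝒰 := ⟨⟨fun _ j => j, fun _ _ => rfl, fun _ _ => le_rfl⟩⟩
  le_trans := by
    rintro 𝒰 𝒱 𝒲 ⟨r⟩ ⟨s⟩
    exact ⟨⟨fun n k => r.θ n (s.θ n k), fun n k => by rw [s.θ_bar, r.θ_bar],
      fun n k => le_trans (s.le n k) (r.le n _)⟩⟩

/-- The canonical map `HR^n(𝒰, F) ⟶ HR^n(𝒱, F)` for `𝒰 ≼ 𝒱` in `𝔑(n)`, induced by any refinement
(all refinements `𝒱 ⟶ 𝒰` induce cochain homotopic maps in the relevant degrees, as `𝒱` has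
degeneracies up to level `n + 1`, so the choice made here is immaterial). -/
def transition (F : RealPresheaf X) (n : ℕ) (𝒰 𝒱 : CoverSystem X n) (h : 𝒰 ≤ 𝒱) :
    HR 𝒰.cover F n →+ HR 𝒱.cover F n :=
  HR.refine (Classical.choice h) F n

open Classical in
/-- Real Čech cohomology: the direct limit of the groups `HR^n(𝒰, F)` over `𝔑(n)`. -/
def CechHR (F : RealPresheaf X) (n : ℕ) : Type (u + 1) :=
  AddCommGroup.DirectLimit (fun 𝒰 : CoverSystem X n => HR 𝒰.cover F n) (transition F n)

open Classical in
instance (F : RealPresheaf X) (n : ℕ) : AddCommGroup (CechHR F n) :=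
  inferInstanceAs (AddCommGroup
    (AddCommGroup.DirectLimit (fun 𝒰 : CoverSystem X n => HR 𝒰.cover F n) (transition F n)))

open Classical in
/-- The canonical map from `HR^n(𝒰, F)`, `𝒰 ∈ 𝔑(n)`, to the Real Čech cohomology group. -/
def CechHR.of (F : RealPresheaf X) (n : ℕ) (𝒰 : CoverSystem X n) :
    HR 𝒰.cover F n →+ CechHR F n :=
  AddCommGroup.DirectLimit.of (fun 𝒰 : CoverSystem X n => HR 𝒰.cover F n) (transition F n) 𝒰

/-- The class in Real Čech cohomology of a Real cocycle relative to `𝒰 ∈ 𝔑(n)`. -/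
def CechHR.cls {F : RealPresheaf X} {n : ℕ} (𝒰 : CoverSystem X n)
    (z : cocycle 𝒰.cover.nat F n) : CechHR F n :=
  CechHR.of F n 𝒰 (QuotientAddGroup.mk z)

lemma RealPresheaf.Hom.mapHR_transition {F G : RealPresheaf X} (φ : F.Hom G) (n : ℕ)
    (𝒰 𝒱 : CoverSystem X n) (h : 𝒰 ≤ 𝒱) :
    (φ.mapHR 𝒱.cover n).comp (transition F n 𝒰 𝒱 h) =
      (transition G n 𝒰 𝒱 h).comp (φ.mapHR 𝒰.cover n) := by
  ext z
  change (QuotientAddGroup.mk _ : HR 𝒱.cover G n) = QuotientAddGroup.mk _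
  congr 1
  apply Subtype.ext
  apply Subtype.ext
  funext j
  exact ConcreteCategory.congr_hom ((φ.app n).naturality
    (homOfLE ((Classical.choice h).nat.le n j)).op) _

open Classical in
/-- The homomorphism `φ_*` induced by `φ` in Real Čech cohomology. -/
def RealPresheaf.Hom.mapCech {F G : RealPresheaf X} (φ : F.Hom G) (n : ℕ) :
    CechHR F n →+ CechHR G n :=
  AddCommGroup.DirectLimit.map (f := transition F n) (f' := transition G n)
    (fun 𝒰 : CoverSystem X n => φ.mapHR 𝒰.cover n) (φ.mapHR_transition n)

end RealCech

end

noncomputable section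

namespace RealCech

variable {X : RealSimplicialSpace.{u}}

/-! ### Independence of the choice of refinement -/

/-! Over every Real cover the Real cochains form a left exact sequence of complexes, because the
given sequence is left exact on sections. Surjectivity onto cochains with values in `F''` fails over
a fixed cover but holds after refinement. These properties form `CechShortExact`; from them the
usual diagram chase runs in the direct limit, with a further refinement wherever a cochain must be
lifted or a coboundary exhibited.

Lifting. Even for presheaves, an index equal to its conjugate would require a lift invariant under
`σ`. Doubling the cover makes the involution on indices free: one lifts at a representative of each
orbit and conjugates (`exists_lift_of_sign`). For sheaves, lifts exist only locally. Paracompactness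
gives a locally finite closed shrinking, so that near a point only finitely many components of a
cochain matter and one neighbourhood serves them all (`LocallySurjective.exists_nhd`). Such
neighbourhoods and their conjugates form the required refinement.

The limit. The transition maps are induced by arbitrarily chosen refinements, so one needs that two
refinements agree on cohomology (`HR.refine_eq`). A prism homotopy proves this. It pulls back along
degeneracies, hence needs indices `λ(h)` for non-injective `h`; these come from the simplicial
structure on the skeleton of the finer cover, needed up to dimension `n + 1`. Every Real cover has a
refinement in `𝔑(n)` (`RealCover.simplicial`), so the system is directed and refining is free.

The connecting map is obtained from its graph `IsConnecting`, which is total, single-valued and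
closed under subtraction. -/

lemma strictMono_of_mono {x y : SimplexCategory} (f : x ⟶ y) [Mono f] :
    StrictMono f.toOrderHom :=
  f.toOrderHom.monotone.strictMono_of_injective (SimplexCategory.mono_iff_injective.1 inferInstance)

lemma Inc.mono {k n : ℕ} (φ : Inc k n) : Mono φ.1 :=
  SimplexCategory.mono_iff_injective.2 φ.2.injective

/-- The monomorphism has the same range as the composite, and a strictly monotone map between finite
ordinals is determined by its range; it can then be cancelled. -/
lemma epiMono_factorization_unique {x y z : SimplexCategory} {e e' : x ⟶ y} {i i' : y ⟶ z}
    [Epi e] [Epi e'] [Mono i] [Mono i'] (h : e ≫ i = e' ≫ i') : e = e' ∧ i = i' := by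
  have range_eq : ∀ (e : x ⟶ y) (i : y ⟶ z) [Epi e],
      Set.range i.toOrderHom = Set.range (e ≫ i).toOrderHom := by
    intro e i _
    have hs : Function.Surjective e.toOrderHom := SimplexCategory.epi_iff_surjective.1 inferInstance
    exact (hs.range_comp i.toOrderHom).symm
  have hi : i = i' := by
    have := (StrictMono.range_inj (strictMono_of_mono i) (strictMono_of_mono i')).1
      (by rw [range_eq e i, range_eq e' i', h])
    exact SimplexCategory.Hom.ext _ _ (OrderHom.ext _ _ this)
  subst hi
  exact ⟨(cancel_mono i).1 h, rfl⟩

/-- The index `e^*(λ(ι))`, where `h = e ≫ ι` is the epi-mono factorization of `h : [m] ⟶ [p]`. -/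
def NSimplicialStructure.pullIndex {𝒱 : RealCover X} {N : ℕ} (S : NSimplicialStructure 𝒱 N)
    {m p : ℕ} (hm : m ≤ N) (h : ⦋m⦌ ⟶ ⦋p⦌) (l : 𝒱.Λ p) : 𝒱.J m :=
  S.map (n := (Limits.image h).len) hm
    ((SimplexCategory.len_le_of_epi (Limits.factorThruImage h)).trans hm)
    (Limits.factorThruImage h) (l _ ⟨Limits.image.ι h, strictMono_of_mono _⟩)

/-- By uniqueness of the epi-mono factorization, any factorization computes the index. Compatibility
with increasing maps follows by exhibiting convenient factorizations. -/
lemma NSimplicialStructure.pullIndex_eq {𝒱 : RealCover X} {N : ℕ} (S : NSimplicialStructure 𝒱 N)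
    {m k p : ℕ} (hm : m ≤ N) (hk : k ≤ N) (h : ⦋m⦌ ⟶ ⦋p⦌) (e : ⦋m⦌ ⟶ ⦋k⦌) [Epi e] (ι : Inc k p)
    (he : e ≫ ι.1 = h) (l : 𝒱.Λ p) :
    S.pullIndex hm h l = S.map hm hk e (l k ι) := by
  have := ι.mono
  -- The image is equal to `⦋k⦌` only propositionally; with a variable object in its place the
  -- equality can be substituted.
  have key : ∀ (y : SimplexCategory) (hy : y = ⦋k⦌) (hy' : y.len ≤ N) (e' : ⦋m⦌ ⟶ y)
      (i' : y ⟶ ⦋p⦌) [Epi e'] [Mono i'] (_ : e' ≫ i' = h),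
      S.map (n := y.len) hm hy' e' (l y.len ⟨i', strictMono_of_mono i'⟩) =
        S.map hm hk e (l k ι) := by
    rintro y rfl hy' e' i' _ _ h'
    obtain ⟨rfl, h₂⟩ := epiMono_factorization_unique (h'.trans he.symm)
    have : ι = ⟨i', strictMono_of_mono i'⟩ := Subtype.ext h₂.symm
    rw [this]
  exact key _ (SimplexCategory.image_eq he) _ _ _ (Limits.image.fac h)

lemma NSimplicialStructure.pullIndex_map {𝒱 : RealCover X} {N : ℕ} (S : NSimplicialStructure 𝒱 N)
    {m p q : ℕ} (hm : m ≤ N) (h : ⦋m⦌ ⟶ ⦋p⦌) (f : Inc p q) (l : 𝒱.Λ q) :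
    S.pullIndex hm h (𝒱.nat.map f l) = S.pullIndex hm (h ≫ f.1) l := by
  symm
  exact S.pullIndex_eq hm _ _ (Limits.factorThruImage h)
    (f.comp ⟨Limits.image.ι h, strictMono_of_mono _⟩)
    ((Category.assoc _ _ _).symm.trans (congrArg (· ≫ f.1) (Limits.image.fac h))) l

lemma NSimplicialStructure.pullIndex_inc {𝒱 : RealCover X} {N : ℕ} (S : NSimplicialStructure 𝒱 N)
    {m p : ℕ} (hm : m ≤ N) (φ : Inc m p) (l : 𝒱.Λ p) :
    S.pullIndex hm φ.1 l = l m φ := by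
  rw [S.pullIndex_eq hm hm φ.1 (𝟙 _) φ (Category.id_comp _), S.map_id]

lemma NSimplicialStructure.pullIndex_bar {𝒱 : RealCover X} {N : ℕ} (S : NSimplicialStructure 𝒱 N)
    {m p : ℕ} (hm : m ≤ N) (h : ⦋m⦌ ⟶ ⦋p⦌) (l : 𝒱.Λ p) :
    S.pullIndex hm h (𝒱.nat.bar p l) = 𝒱.bar m (S.pullIndex hm h l) :=
  S.map_bar _ _ _ _

lemma NSimplicialStructure.mem_pullIndex {𝒱 : RealCover X} {N : ℕ} (S : NSimplicialStructure 𝒱 N)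
    {m p : ℕ} (hm : m ≤ N) (h : ⦋m⦌ ⟶ ⦋p⦌) (l : 𝒱.Λ p) (x : X.space p) (hx : x ∈ 𝒱.natU p l) :
    X.face h x ∈ 𝒱.U m (S.pullIndex hm h l) := by
  have h₁ := S.le_map (n := (Limits.image h).len) hm
    ((SimplexCategory.len_le_of_epi (Limits.factorThruImage h)).trans hm)
    (Limits.factorThruImage h) _ (hx _ ⟨Limits.image.ι h, strictMono_of_mono _⟩)
  have h₂ : X.face h x = X.face (m := m) (n := (Limits.image h).len) (Limits.factorThruImage h)
      (X.face (m := (Limits.image h).len) (Limits.image.ι h) x) := by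
    conv_lhs => rw [← Limits.image.fac h]
    exact X.face_comp (m := (Limits.image h).len) (Limits.factorThruImage h) (Limits.image.ι h) x
  rw [h₂]
  exact h₁

/-! ### Prism operators for a pair of refinements -/

section prism

variable {𝒰 𝒱 : RealCover X} {N : ℕ} (S : NSimplicialStructure 𝒱 N)
  (r : Bool → Refinement 𝒰 𝒱) {q p : ℕ} (hq : q ≤ N)

/-- The index in `Λ_q` of `𝒰` attached to `λ ∈ Λ_p` of `𝒱` by a map `[q] ⟶ [p]` and a choice of
one of two refinements at each vertex of `[q]`. -/
def prismIndex (g : ⦋q⦌ ⟶ ⦋p⦌) (χ : Fin (q + 1) → Bool) (l : 𝒱.Λ p) : 𝒰.Λ q :=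
  fun m φ => (r (χ (φ.1.toOrderHom 0))).θ m (S.pullIndex (φ.le.trans hq) (φ.1 ≫ g) l)

lemma prismIndex_bar (g : ⦋q⦌ ⟶ ⦋p⦌) (χ : Fin (q + 1) → Bool) (l : 𝒱.Λ p) :
    prismIndex S r hq g χ (𝒱.nat.bar p l) = 𝒰.nat.bar q (prismIndex S r hq g χ l) := by
  funext m φ
  simp only [prismIndex, S.pullIndex_bar]
  exact (r _).θ_bar _ _

lemma natU_le_prismIndex (g : ⦋q⦌ ⟶ ⦋p⦌) (χ : Fin (q + 1) → Bool) (l : 𝒱.Λ p) :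
    𝒱.natU p l ≤ X.preim g (𝒰.natU q (prismIndex S r hq g χ l)) := by
  intro x hx m φ
  have h := S.mem_pullIndex (φ.le.trans hq) (φ.1 ≫ g) l x hx
  rw [X.face_comp] at h
  exact (r _).le _ _ h

/-- The refinement used on a face is decided by its first vertex. This rule is stable under passing
to faces, since the first vertex of the image of a face is the image of its first vertex. -/
lemma map_prismIndex {s : ℕ} (hs : s ≤ N) (g : ⦋q⦌ ⟶ ⦋p⦌) (χ : Fin (q + 1) → Bool) (f : Inc s q)
    (l : 𝒱.Λ p) : 𝒰.nat.map f (prismIndex S r hq g χ l) =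
      prismIndex S r hs (f.1 ≫ g) (fun i => χ (f.1.toOrderHom i)) l := by
  funext m φ
  change (r (χ ((f.comp φ).1.toOrderHom 0))).θ m
    (S.pullIndex ((f.comp φ).le.trans hq) ((φ.1 ≫ f.1) ≫ g) l) = _
  rw [Category.assoc]
  rfl

lemma prismIndex_map {s : ℕ} (g : ⦋q⦌ ⟶ ⦋p⦌) (χ : Fin (q + 1) → Bool) (f : Inc p s)
    (l : 𝒱.Λ s) : prismIndex S r hq g χ (𝒱.nat.map f l) =
      prismIndex S r hq (g ≫ f.1) χ l := by
  funext m φ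
  simp only [prismIndex, S.pullIndex_map, Category.assoc]

lemma prismIndex_id (b : Bool) (l : 𝒱.Λ q) :
    prismIndex S r hq (𝟙 _) (fun _ => b) l = (r b).nat.θ q l := by
  funext m φ
  simp only [prismIndex, Category.comp_id, S.pullIndex_inc]
  rfl

variable (F : RealPresheaf X)

/-- The homomorphism of cochain groups given by pulling back along `g : [q] ⟶ [p]`. -/
def prism (g : ⦋q⦌ ⟶ ⦋p⦌) (χ : Fin (q + 1) → Bool) :
    cochain 𝒰.nat F q →+ cochain 𝒱.nat F p where
  toFun c := ⟨fun l => F.pull g _ _ (natU_le_prismIndex S r hq g χ l)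
      (c.1 (prismIndex S r hq g χ l)), fun l => by
    have key : ∀ (a : 𝒰.Λ q) (_ : a = 𝒰.nat.bar q (prismIndex S r hq g χ l))
        (h : 𝒱.nat.U p (𝒱.nat.bar p l) ≤ X.preim g (𝒰.nat.U q a)),
        F.pull g (𝒰.nat.U q a) (𝒱.nat.U p (𝒱.nat.bar p l)) h (c.1 a) =
        F.σ p (𝒱.nat.U p l) (𝒱.nat.U p (𝒱.nat.bar p l)) (𝒱.nat.U_bar p l)
          (F.pull g _ _ (natU_le_prismIndex S r hq g χ l) (c.1 (prismIndex S r hq g χ l))) := by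
      rintro a rfl h
      rw [c.2 (prismIndex S r hq g χ l)]
      exact (ConcreteCategory.congr_hom (F.σ_pull g _ _ _ _
        (𝒰.nat.U_bar q (prismIndex S r hq g χ l)) (𝒱.nat.U_bar p l)
        (natU_le_prismIndex S r hq g χ l) h) _).symm
    exact key _ (prismIndex_bar S r hq g χ l) _⟩
  map_zero' := by
    apply Subtype.ext
    funext j
    exact map_zero _
  map_add' c c' := by
    apply Subtype.ext
    funext j
    exact map_add _ _ _

lemma prism_congr {g g' : ⦋q⦌ ⟶ ⦋p⦌} {χ χ' : Fin (q + 1) → Bool} (hg : g = g') (hχ : χ = χ') :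
    prism S r hq F g χ = prism S r hq F g' χ' := by
  rw [hg, hχ]

/-- Values of a cochain pulled back along composable maps agree with those along the composite. -/
lemma pull_pull_eq {k m n : ℕ} (g : ⦋k⦌ ⟶ ⦋m⦌) (f : ⦋m⦌ ⟶ ⦋n⦌) (c : cochain 𝒰.nat F k)
    {a b : 𝒰.Λ k} (hab : a = b) {V : Opens (X.space m)} {U : Opens (X.space n)}
    (hg : V ≤ X.preim g (𝒰.natU k a)) (hf : U ≤ X.preim f V)
    (hb : U ≤ X.preim (g ≫ f) (𝒰.natU k b)) :
    F.pull f V U hf (F.pull g (𝒰.natU k a) V hg (c.1 a)) =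
      F.pull (g ≫ f) (𝒰.natU k b) U hb (c.1 b) := by
  subst hab
  exact ConcreteCategory.congr_hom (F.pull_comp g f _ _ _ hg hf hb) _

lemma coface_prism (g : ⦋q⦌ ⟶ ⦋p⦌) (χ : Fin (q + 1) → Bool) (i : Fin (p + 2))
    (c : cochain 𝒰.nat F q) : coface 𝒱.nat F i (prism S r hq F g χ c) =
      prism S r hq F (g ≫ SimplexCategory.δ i) χ c := by
  apply Subtype.ext
  funext l
  exact pull_pull_eq F g (SimplexCategory.δ i) c (prismIndex_map S r hq g χ (Inc.ε i) l) _ _ _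

/-- A coface on the coarse side deletes a vertex of `[q + 1]` together with its colour, whereas a
coface on the fine side (`coface_prism`) leaves the colouring alone. -/
lemma prism_coface (hq' : q + 1 ≤ N) (g : ⦋q + 1⦌ ⟶ ⦋p⦌) (χ : Fin (q + 2) → Bool)
    (i : Fin (q + 2)) (c : cochain 𝒰.nat F q) : prism S r hq' F g χ (coface 𝒰.nat F i c) =
      prism S r hq F (SimplexCategory.δ i ≫ g) (fun j => χ (i.succAbove j)) c := by
  apply Subtype.ext
  funext l
  exact pull_pull_eq F (SimplexCategory.δ i) g c (map_prismIndex S r hq' hq g χ (Inc.ε i) l) _ _ _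

lemma prism_id (b : Bool) (c : cochain 𝒰.nat F q) :
    prism S r hq F (𝟙 _) (fun _ => b) c = (r b).nat.cochainMap F q c := by
  apply Subtype.ext
  funext l
  have key : ∀ (a : 𝒰.Λ q) (_ : a = (r b).nat.θ q l)
      (h : 𝒱.natU q l ≤ X.preim (𝟙 ⦋q⦌) (𝒰.natU q a)),
      F.pull (𝟙 _) (𝒰.natU q a) (𝒱.natU q l) h (c.1 a) =
        ((r b).nat.cochainMap F q c).1 l := by
    rintro a rfl h
    rw [F.pull_id _ _ h ((r b).nat.le q l)]
    rfl
  exact key _ (prismIndex_id S r hq b l) _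

end prism

/-- The combinatorics of the prism. The terms `a k i` with `i < k` or `i > k + 1` cancel against the
two halves of `b`; those with `i = k` and `i = k + 1` are the internal walls, which telescope. -/
lemma prism_sum_eq {A : Type*} [AddCommGroup A] (q : ℕ) (a : Fin (q + 2) → Fin (q + 3) → A)
    (b : Fin (q + 1) → Fin (q + 2) → A) (t : ℕ → A)
    (h₀ : ∀ k : Fin (q + 2), a k k.castSucc = t k)
    (h₁ : ∀ k : Fin (q + 2), a k k.succ = -t (k + 1))
    (h₂ : ∀ (k : Fin (q + 1)) (i : Fin (q + 2)), (i : ℕ) ≤ k → a k.succ i.castSucc = -b k i)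
    (h₃ : ∀ (k : Fin (q + 1)) (i : Fin (q + 2)), (k : ℕ) < i → a k.castSucc i.succ = -b k i) :
    ∑ k, ∑ i, a k i + ∑ k, ∑ i, b k i = t 0 - t (q + 2) := by
  rw [← Fintype.sum_prod_type', ← Fintype.sum_prod_type']
  rw [← Finset.sum_filter_add_sum_filter_not Finset.univ
    (fun p : Fin (q + 2) × Fin (q + 3) => (p.2 : ℕ) < p.1) (fun p => a p.1 p.2),
    ← Finset.sum_filter_add_sum_filter_not (Finset.univ.filter
      (fun p : Fin (q + 2) × Fin (q + 3) => ¬ (p.2 : ℕ) < p.1))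
    (fun p => (p.1 : ℕ) + 1 < p.2) (fun p => a p.1 p.2),
    ← Finset.sum_filter_add_sum_filter_not ((Finset.univ.filter
      (fun p : Fin (q + 2) × Fin (q + 3) => ¬ (p.2 : ℕ) < p.1)).filter
        (fun p => ¬ (p.1 : ℕ) + 1 < p.2))
    (fun p => (p.1 : ℕ) = p.2) (fun p => a p.1 p.2),
    ← Finset.sum_filter_add_sum_filter_not Finset.univ
    (fun p : Fin (q + 1) × Fin (q + 2) => (p.2 : ℕ) ≤ p.1) (fun p => b p.1 p.2)]
  have e₂ : ∑ p : Fin (q + 1) × Fin (q + 2) with (p.2 : ℕ) ≤ p.1, -b p.1 p.2 =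
      ∑ p : Fin (q + 2) × Fin (q + 3) with (p.2 : ℕ) < p.1, a p.1 p.2 := by
    refine Finset.sum_bij (fun p _ => (p.1.succ, p.2.castSucc)) ?_ ?_ ?_ ?_
    · rintro ⟨k, i⟩ h
      simp at h ⊢
      omega
    · rintro ⟨k, i⟩ _ ⟨k', i'⟩ _ h
      simpa using h
    · rintro ⟨k, i⟩ h
      simp at h
      refine ⟨(k.pred (by rintro rfl; simp at h), i.castPred (by rintro rfl; simp at h; omega)),
        ?_, ?_⟩
      · simp
        omega
      · simp
    · rintro ⟨k, i⟩ h
      simp at h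
      exact (h₂ k i h).symm
  have e₃ : ∑ p : Fin (q + 1) × Fin (q + 2) with ¬ (p.2 : ℕ) ≤ p.1, -b p.1 p.2 =
      ∑ p ∈ (Finset.univ.filter (fun p : Fin (q + 2) × Fin (q + 3) => ¬ (p.2 : ℕ) < p.1)).filter
        (fun p => (p.1 : ℕ) + 1 < p.2), a p.1 p.2 := by
    refine Finset.sum_bij (fun p _ => (p.1.castSucc, p.2.succ)) ?_ ?_ ?_ ?_
    · rintro ⟨k, i⟩ h
      simp at h ⊢
      omega
    · rintro ⟨k, i⟩ _ ⟨k', i'⟩ _ h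
      simpa using h
    · rintro ⟨k, i⟩ h
      simp at h
      refine ⟨(k.castPred (by rintro rfl; simp at h; omega), i.pred (by rintro rfl; simp at h)),
        ?_, ?_⟩
      · simp
        omega
      · simp
    · rintro ⟨k, i⟩ h
      simp at h
      exact (h₃ k i h).symm
  have e₀ : ∑ k : Fin (q + 2), t k =
      ∑ p ∈ ((Finset.univ.filter (fun p : Fin (q + 2) × Fin (q + 3) => ¬ (p.2 : ℕ) < p.1)).filter
        (fun p => ¬ (p.1 : ℕ) + 1 < p.2)).filter (fun p => (p.1 : ℕ) = p.2), a p.1 p.2 := by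
    refine Finset.sum_bij (fun k _ => (k, k.castSucc)) ?_ ?_ ?_ ?_
    · simp
    · intro k _ k' _ h
      simpa using h
    · rintro ⟨k, i⟩ h
      simp at h
      exact ⟨k, Finset.mem_univ _, Prod.ext rfl (Fin.ext h.2)⟩
    · intro k _
      exact (h₀ k).symm
  have e₁ : ∑ k : Fin (q + 2), -t (k + 1) =
      ∑ p ∈ ((Finset.univ.filter (fun p : Fin (q + 2) × Fin (q + 3) => ¬ (p.2 : ℕ) < p.1)).filter
        (fun p => ¬ (p.1 : ℕ) + 1 < p.2)).filter (fun p => ¬ (p.1 : ℕ) = p.2), a p.1 p.2 := by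
    refine Finset.sum_bij (fun k _ => (k, k.succ)) ?_ ?_ ?_ ?_
    · simp
    · intro k _ k' _ h
      simpa using h
    · rintro ⟨k, i⟩ h
      simp at h
      refine ⟨k, Finset.mem_univ _, Prod.ext rfl (Fin.ext ?_)⟩
      simp
      omega
    · intro k _
      exact (h₁ k).symm
  rw [← e₀, ← e₁, ← e₂, ← e₃, Finset.sum_neg_distrib, Finset.sum_neg_distrib,
    Finset.sum_neg_distrib, Fin.sum_univ_eq_sum_range, Fin.sum_univ_eq_sum_range (fun k => t (k + 1)),
    ← Finset.sum_range_sub' t (q + 2), Finset.sum_sub_distrib]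
  abel

/-- The function that is `true` from `k` on. -/
def cut (q k : ℕ) : Fin (q + 1) → Bool := fun i => decide (k ≤ (i : ℕ))

lemma cut_zero (q : ℕ) : cut q 0 = fun _ => true := by
  funext i
  simp [cut]

lemma cut_last (q : ℕ) : cut q (q + 1) = fun _ => false := by
  funext i
  simp only [cut, decide_eq_false_iff_not]
  omega

/-- The deleted vertex lies in the `false` part, so the cut moves down by one; in
`cut_succAbove_of_lt` it lies in the `true` part and the cut stays. -/
lemma cut_succAbove_of_le (q k : ℕ) (i : Fin (q + 2)) (h : (i : ℕ) ≤ k) :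
    (fun j => cut (q + 1) (k + 1) (i.succAbove j)) = cut q k := by
  funext j
  simp only [cut, decide_eq_decide, Fin.succAbove, Fin.lt_def]
  split_ifs with h' <;> simp at h' ⊢
  omega

lemma cut_succAbove_of_lt (q k : ℕ) (i : Fin (q + 2)) (h : k < (i : ℕ)) :
    (fun j => cut (q + 1) (k + 1) (i.succAbove j)) = cut q (k + 1) := by
  funext j
  simp only [cut, decide_eq_decide, Fin.succAbove, Fin.lt_def]
  split_ifs with h' <;> simp at h' ⊢
  omega

/-! ### The prism homotopy -/

section homotopy

variable {𝒰 𝒱 : RealCover X} {N : ℕ} (S : NSimplicialStructure 𝒱 N)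
  (r : Bool → Refinement 𝒰 𝒱) (F : RealPresheaf X)

/-- The cochain homotopy between the maps induced by two refinements. -/
def prismHomotopy {q : ℕ} (hq : q + 1 ≤ N) : cochain 𝒰.nat F (q + 1) →+ cochain 𝒱.nat F q :=
  ∑ k : Fin (q + 1), ((-1 : ℤ) ^ (k : ℕ)) •
    prism S r hq F (SimplexCategory.σ k) (cut (q + 1) (k + 1))

lemma prismHomotopy_apply {q : ℕ} (hq : q + 1 ≤ N) (c : cochain 𝒰.nat F (q + 1)) :
    prismHomotopy S r F hq c = ∑ k : Fin (q + 1), ((-1 : ℤ) ^ (k : ℕ)) •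
      prism S r hq F (SimplexCategory.σ k) (cut (q + 1) (k + 1)) c := by
  simp [prismHomotopy]

lemma prismHomotopy_d {q : ℕ} (hq : q + 1 ≤ N) (c : cochain 𝒰.nat F q) :
    prismHomotopy S r F hq (d 𝒰.nat F q c) = ∑ k : Fin (q + 1), ∑ i : Fin (q + 2),
      ((-1 : ℤ) ^ ((k : ℕ) + i)) • prism S r (Nat.le_of_succ_le hq) F
        (SimplexCategory.δ i ≫ SimplexCategory.σ k)
        (fun j => cut (q + 1) (k + 1) (i.succAbove j)) c := by
  rw [prismHomotopy_apply, d_apply]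
  refine Finset.sum_congr rfl fun k _ => ?_
  rw [map_sum, Finset.smul_sum]
  refine Finset.sum_congr rfl fun i _ => ?_
  rw [map_zsmul, smul_smul, ← pow_add, prism_coface S r (Nat.le_of_succ_le hq)]

lemma d_prismHomotopy {q : ℕ} (hq : q + 1 ≤ N) (c : cochain 𝒰.nat F (q + 1)) :
    d 𝒱.nat F q (prismHomotopy S r F hq c) = ∑ k : Fin (q + 1), ∑ i : Fin (q + 2),
      ((-1 : ℤ) ^ ((k : ℕ) + i)) • prism S r hq F
        (SimplexCategory.σ k ≫ SimplexCategory.δ i) (cut (q + 1) (k + 1)) c := by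
  rw [prismHomotopy_apply, map_sum]
  refine Finset.sum_congr rfl fun k _ => ?_
  rw [d_apply]
  refine Finset.sum_congr rfl fun i _ => ?_
  rw [map_zsmul, coface_prism, smul_smul, ← pow_add, add_comm (i : ℕ)]

/-- In degree zero there is a single prism and no term with the differential outside; its two faces
are the two refinements. -/
lemma prismHomotopy_d_zero (hN : 1 ≤ N) (c : cochain 𝒰.nat F 0) :
    prismHomotopy S r F hN (d 𝒰.nat F 0 c) =
      (r true).nat.cochainMap F 0 c - (r false).nat.cochainMap F 0 c := by
  rw [prismHomotopy_d, ← prism_id S r (Nat.zero_le N), ← prism_id S r (Nat.zero_le N)]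
  rw [Fin.sum_univ_succ, Fin.sum_univ_zero, Fin.sum_univ_succ, Fin.sum_univ_succ, Fin.sum_univ_zero]
  rw [prism_congr S r _ F (Subsingleton.elim _ (𝟙 _))
      ((cut_succAbove_of_le 0 ((0 : Fin 1) : ℕ) 0 le_rfl).trans (cut_zero 0)),
    prism_congr S r _ F (Subsingleton.elim _ (𝟙 _))
      ((cut_succAbove_of_lt 0 ((0 : Fin 1) : ℕ) (Fin.succ 0) (by simp)).trans (cut_last 0))]
  simp [sub_eq_add_neg]

/-- The simplicial identities between `δ` and `σ` supply the cancellations of `prism_sum_eq`. The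
surviving walls are the colourings `cut _ 0`, constantly `true`, and the last one, constantly
`false`, that is, the two refinements. -/
lemma prismHomotopy_d_add {q : ℕ} (hq : q + 2 ≤ N) (c : cochain 𝒰.nat F (q + 1)) :
    prismHomotopy S r F hq (d 𝒰.nat F (q + 1) c) +
        d 𝒱.nat F q (prismHomotopy S r F (Nat.le_of_succ_le hq) c) =
      (r true).nat.cochainMap F (q + 1) c - (r false).nat.cochainMap F (q + 1) c := by
  have hq' := Nat.le_of_succ_le hq
  rw [prismHomotopy_d, d_prismHomotopy, ← prism_id S r hq', ← prism_id S r hq',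
    ← cut_zero, ← cut_last]
  refine prism_sum_eq q _ _ (fun k => prism S r hq' F (𝟙 _) (cut (q + 1) k) c) ?_ ?_ ?_ ?_
  · intro k
    rw [prism_congr S r _ F SimplexCategory.δ_comp_σ_self
      (cut_succAbove_of_le (q + 1) k k.castSucc le_rfl)]
    simp [← two_mul]
  · intro k
    rw [prism_congr S r _ F SimplexCategory.δ_comp_σ_succ
      (cut_succAbove_of_lt (q + 1) k k.succ (by simp))]
    simp [← add_assoc, ← two_mul, pow_succ]
  · intro k i h
    rw [prism_congr S r _ F (SimplexCategory.δ_comp_σ_of_le (i := i) (j := k)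
      (by simpa [Fin.le_def] using h))
      (cut_succAbove_of_le (q + 1) k.succ i.castSucc (by simp; omega)), ← neg_smul]
    simp [pow_succ, pow_add]
  · intro k i h
    rw [prism_congr S r _ F (SimplexCategory.δ_comp_σ_of_gt (i := i) (j := k)
      (by simpa [Fin.lt_def] using h))
      (cut_succAbove_of_lt (q + 1) k.castSucc i.succ (by simp; omega)), ← neg_smul]
    simp [pow_succ, pow_add]

end homotopy

/-- The homotopy is applied to `dc`, of degree `n + 1`, which is where a simplicial structure up to
level `n + 1` is needed. For `n = 0` there are no nonzero coboundaries and the homotopy gives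
equality. -/
lemma Refinement.cochainMap_sub_mem_coboundary {𝒰 𝒱 : RealCover X} {n : ℕ}
    (h : 𝒱.IsAdmissible n) (r₀ r₁ : Refinement 𝒰 𝒱) (F : RealPresheaf X)
    (c : cochain 𝒰.nat F n) (hc : d 𝒰.nat F n c = 0) :
    r₁.nat.cochainMap F n c - r₀.nat.cochainMap F n c ∈ coboundary 𝒱.nat F n := by
  obtain ⟨N, hN, ⟨S⟩⟩ := h
  let r : Bool → Refinement 𝒰 𝒱 := fun b => if b then r₁ else r₀
  cases n with
  | zero =>
    have := prismHomotopy_d_zero S r F hN c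
    rw [hc, map_zero] at this
    exact this.symm
  | succ n =>
    have := prismHomotopy_d_add S r F hN c
    rw [hc, map_zero, zero_add] at this
    exact ⟨_, this⟩

/-! ### Operations on Real covers -/

lemma RealSimplicialSpace.inv_inv (X : RealSimplicialSpace.{u}) {n : ℕ} (x : X.space n) :
    X.inv n (X.inv n x) = x :=
  ConcreteCategory.congr_hom (congrArg (fun f => f.app (op ⦋n⦌)) X.ρ_ρ) x

lemma RealSimplicialSpace.conj_conj (X : RealSimplicialSpace.{u}) {n : ℕ}
    (U : Opens (X.space n)) : X.conj (X.conj U) = U := by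
  ext x
  change X.inv n (X.inv n x) ∈ U ↔ x ∈ U
  rw [X.inv_inv]

lemma RealSimplicialSpace.face_id (X : RealSimplicialSpace.{u}) {n : ℕ} (x : X.space n) :
    X.face (𝟙 ⦋n⦌) x = x :=
  ConcreteCategory.congr_hom (X.X.map_id (op ⦋n⦌)) x

lemma RealCover.mem_bar (𝒰 : RealCover X) {n : ℕ} (j : 𝒰.J n) (x : X.space n) :
    x ∈ 𝒰.U n (𝒰.bar n j) ↔ X.inv n x ∈ 𝒰.U n j := by
  rw [𝒰.U_bar]
  rfl

/-- Composition of refinements. -/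
def Refinement.trans {𝒰 𝒱 𝒲 : RealCover X} (r : Refinement 𝒰 𝒱) (s : Refinement 𝒱 𝒲) :
    Refinement 𝒰 𝒲 where
  θ n k := r.θ n (s.θ n k)
  θ_bar n k := by rw [s.θ_bar, r.θ_bar]
  le n k := (s.le n k).trans (r.le n _)

lemma Refinement.cochainMap_trans {𝒰 𝒱 𝒲 : RealCover X} (r : Refinement 𝒰 𝒱)
    (s : Refinement 𝒱 𝒲) (F : RealPresheaf X) (n : ℕ) (c : cochain 𝒰.nat F n) :
    (r.trans s).nat.cochainMap F n c = s.nat.cochainMap F n (r.nat.cochainMap F n c) := by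
  apply Subtype.ext
  funext l
  exact ConcreteCategory.congr_hom ((F.sec n).map_comp
    (homOfLE (r.nat.le n (s.nat.θ n l))).op (homOfLE (s.nat.le n l)).op) _

lemma RealPresheaf.Hom.cochainMap_refine {𝒰 𝒱 : RealCover X} {F G : RealPresheaf X}
    (φ : F.Hom G) (r : Refinement 𝒰 𝒱) (n : ℕ) (c : cochain 𝒰.nat F n) :
    φ.cochainMap 𝒱.nat n (r.nat.cochainMap F n c) =
      r.nat.cochainMap G n (φ.cochainMap 𝒰.nat n c) := by
  apply Subtype.ext
  funext l
  exact ConcreteCategory.congr_hom ((φ.app n).naturality (homOfLE (r.nat.le n l)).op) _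

/-- The Real cover by the intersections of the members of two Real covers. -/
def RealCover.inter (𝒰 𝒱 : RealCover X) : RealCover X where
  J n := 𝒰.J n × 𝒱.J n
  bar n j := (𝒰.bar n j.1, 𝒱.bar n j.2)
  bar_bar n j := by rw [𝒰.bar_bar, 𝒱.bar_bar]
  U n j := 𝒰.U n j.1 ⊓ 𝒱.U n j.2
  U_bar n j := by
    rw [𝒰.U_bar, 𝒱.U_bar]
    rfl
  covers n x := by
    obtain ⟨i, hi⟩ := 𝒰.covers n x
    obtain ⟨j, hj⟩ := 𝒱.covers n x
    exact ⟨(i, j), hi, hj⟩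

/-- `𝒰 ∩ 𝒱` refines `𝒰`. -/
def RealCover.interLeft (𝒰 𝒱 : RealCover X) : Refinement 𝒰 (𝒰.inter 𝒱) where
  θ _ j := j.1
  θ_bar _ _ := rfl
  le _ _ := inf_le_left

/-- `𝒰 ∩ 𝒱` refines `𝒱`. -/
def RealCover.interRight (𝒰 𝒱 : RealCover X) : Refinement 𝒱 (𝒰.inter 𝒱) where
  θ _ j := j.2
  θ_bar _ _ := rfl
  le _ _ := inf_le_right

variable (X) in
/-- The Real cover with one member at each level. -/
def RealCover.trivial : RealCover X where
  J _ := PUnit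
  bar _ j := j
  bar_bar _ _ := rfl
  U _ _ := ⊤
  U_bar _ _ := rfl
  covers _ _ := ⟨⟨⟩, _root_.trivial⟩

/-- The refinement of `𝒰` indexed by the families `λ(φ) ∈ J_k`, for all nondecreasing
`φ : [k] ⟶ [n]` with `k ≤ max N n`. -/
def RealCover.simplicial (𝒰 : RealCover X) (N : ℕ) : RealCover X where
  -- For `n ≤ N` the bound is the constant `N`, so composing with maps between such levels is
  -- allowed. For `n > N` the bound `n` keeps the identity of `[n]` among the `φ`, as the refinement
  -- of `𝒰` requires. Bounding `k` keeps the intersection finite, hence open.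
  J n := ∀ k : ℕ, k ≤ max N n → (⦋k⦌ ⟶ ⦋n⦌) → 𝒰.J k
  bar _ l := fun k hk φ => 𝒰.bar k (l k hk φ)
  bar_bar n l := by
    funext k hk φ
    exact 𝒰.bar_bar k _
  U n l :=
    { carrier := {x | ∀ (k : ℕ) (hk : k ≤ max N n) (φ : ⦋k⦌ ⟶ ⦋n⦌), X.face φ x ∈ 𝒰.U k (l k hk φ)}
      is_open' := by
        have h : {x | ∀ (k : ℕ) (hk : k ≤ max N n) (φ : ⦋k⦌ ⟶ ⦋n⦌),
            X.face φ x ∈ 𝒰.U k (l k hk φ)} =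
            ⋂ p : (Σ k : Fin (max N n + 1), ⦋(k : ℕ)⦌ ⟶ ⦋n⦌), (X.face p.2) ⁻¹'
              (𝒰.U p.1 (l p.1 (Nat.le_of_lt_succ p.1.2) p.2) : Set _) := by
          ext x
          simp only [Set.mem_ofPred_eq, Set.mem_iInter, Sigma.forall]
          exact ⟨fun h k φ => h k _ φ, fun h k hk φ => h ⟨k, Nat.lt_succ_of_le hk⟩ φ⟩
        rw [h]
        exact isOpen_iInter_of_finite fun p => (𝒰.U p.1 _).isOpen.preimage
          (X.face p.2).hom.continuous }
  U_bar n l := by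
    ext x
    change (∀ (k : ℕ) (hk : k ≤ max N n) (φ : ⦋k⦌ ⟶ ⦋n⦌),
      X.face φ x ∈ 𝒰.U k (𝒰.bar k (l k hk φ))) ↔ ∀ (k : ℕ) (hk : k ≤ max N n) (φ : ⦋k⦌ ⟶ ⦋n⦌),
        X.face φ (X.inv n x) ∈ 𝒰.U k (l k hk φ)
    simp only [𝒰.mem_bar, X.face_inv]
  covers n x := by
    choose j hj using fun (k : ℕ) (φ : ⦋k⦌ ⟶ ⦋n⦌) => 𝒰.covers k (X.face φ x)
    exact ⟨fun k _ φ => j k φ, fun k _ φ => hj k φ⟩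

/-- The canonical `N`-simplicial structure of `𝒰.simplicial N`. -/
def RealCover.simplicialStructure (𝒰 : RealCover X) (N : ℕ) :
    NSimplicialStructure (𝒰.simplicial N) N where
  map {m n} hm _ f l := fun k hk φ =>
    l k (hk.trans ((max_eq_left hm).le.trans (le_max_left N n))) (φ ≫ f)
  map_id _ l := by
    funext k hk φ
    exact congrArg (l k hk) (Category.comp_id φ)
  map_comp _ _ _ g f l := by
    funext k hk φ
    exact congrArg (l k _) (Category.assoc φ g f).symm
  map_bar _ _ _ _ := rfl
  le_map hm hn f l x hx := by
    intro k hk φ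
    have h := hx k (hk.trans ((max_eq_left hm).le.trans (le_max_left N _))) (φ ≫ f)
    rw [X.face_comp] at h
    exact h

/-- `𝒰.simplicial N` refines `𝒰`. -/
def RealCover.simplicialRefinement (𝒰 : RealCover X) (N : ℕ) :
    Refinement 𝒰 (𝒰.simplicial N) where
  θ n l := l n (le_max_right N n) (𝟙 _)
  θ_bar _ _ := rfl
  le n l x hx := by
    have h := hx n (le_max_right N n) (𝟙 _)
    rwa [X.face_id] at h

lemma RealCover.isAdmissible_simplicial (𝒰 : RealCover X) (n : ℕ) :
    (𝒰.simplicial (n + 1)).IsAdmissible n :=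
  ⟨n + 1, le_rfl, ⟨𝒰.simplicialStructure _⟩⟩

lemma RealCover.IsAdmissible.of_succ {𝒰 : RealCover X} {n : ℕ} (h : 𝒰.IsAdmissible (n + 1)) :
    𝒰.IsAdmissible n := by
  obtain ⟨N, hN, S⟩ := h
  exact ⟨N, (Nat.le_succ _).trans hN, S⟩

section double

variable (I : ℕ → Type u) (A : ∀ n, I n → Opens (X.space n))
  (hA : ∀ n (x : X.space n), ∃ i, x ∈ A n i)

/-- The Real cover consisting of the members of an open cover and of their conjugates. -/
def RealCover.double : RealCover X where
  J n := I n × Bool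
  bar _ j := (j.1, !j.2)
  bar_bar _ j := by simp
  U n j := if j.2 then A n j.1 else X.conj (A n j.1)
  U_bar n j := by
    obtain ⟨i, _ | _⟩ := j
    · exact (X.conj_conj _).symm
    · rfl
  covers n x := by
    obtain ⟨i, hi⟩ := hA n x
    exact ⟨(i, true), hi⟩

variable {I A hA} {𝒰 : RealCover X} (θ : ∀ n, I n → 𝒰.J n) (hθ : ∀ n i, A n i ≤ 𝒰.U n (θ n i))

/-- If each member of an open cover lies in a member of a Real cover `𝒰`, then its double
refines `𝒰`. -/
def RealCover.doubleRefinement : Refinement 𝒰 (RealCover.double I A hA) where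
  θ n j := if j.2 then θ n j.1 else 𝒰.bar n (θ n j.1)
  θ_bar n j := by
    obtain ⟨i, _ | _⟩ := j
    · exact (𝒰.bar_bar _ _).symm
    · rfl
  le n j := by
    obtain ⟨i, _ | _⟩ := j
    · intro x hx
      exact (𝒰.mem_bar _ _).2 (hθ n i hx)
    · exact hθ n i

end double

/-! ### Classes in Real Čech cohomology -/

section classes

variable {𝒰 𝒱 𝒲 : RealCover X} {F G : RealPresheaf X} {n : ℕ}

/-- The restriction of a cocycle to a refinement. -/
def Refinement.cocycleMap (r : Refinement 𝒰 𝒱) (z : cocycle 𝒰.nat F n) : cocycle 𝒱.nat F n :=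
  ⟨r.nat.cochainMap F n z.1, by
    change d 𝒱.nat F n _ = 0
    rw [r.nat.d_cochainMap, show d 𝒰.nat F n z.1 = 0 from z.2, map_zero]⟩

lemma Refinement.coe_cocycleMap (r : Refinement 𝒰 𝒱) (z : cocycle 𝒰.nat F n) :
    (r.cocycleMap z).1 = r.nat.cochainMap F n z.1 := rfl

/-- The image of a cocycle under a morphism of Real presheaves. -/
def RealPresheaf.Hom.cocycleMap (φ : F.Hom G) (z : cocycle 𝒰.nat F n) : cocycle 𝒰.nat G n :=
  ⟨φ.cochainMap 𝒰.nat n z.1, by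
    change d 𝒰.nat G n _ = 0
    rw [φ.d_cochainMap, show d 𝒰.nat F n z.1 = 0 from z.2, map_zero]⟩

lemma coboundary_le_cocycle (c : cochain 𝒰.nat F n) (hc : c ∈ coboundary 𝒰.nat F n) :
    c ∈ cocycle 𝒰.nat F n := by
  cases n with
  | zero =>
    rw [show c = 0 from hc]
    exact zero_mem _
  | succ n =>
    obtain ⟨b, rfl⟩ := hc
    exact d_d _ _ _ _

lemma HR.mk_eq_mk {z w : cocycle 𝒰.nat F n} :
    (QuotientAddGroup.mk z : HR 𝒰 F n) = QuotientAddGroup.mk w ↔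
      z.1 - w.1 ∈ coboundary 𝒰.nat F n := by
  rw [QuotientAddGroup.eq_iff_sub_mem, AddSubgroup.mem_addSubgroupOf]
  rfl

lemma HR.refine_mk (r : Refinement 𝒰 𝒱) (z : cocycle 𝒰.nat F n) :
    HR.refine r F n (QuotientAddGroup.mk z) = QuotientAddGroup.mk (r.cocycleMap z) := rfl

lemma HR.refine_eq (h : 𝒱.IsAdmissible n) (r s : Refinement 𝒰 𝒱) :
    HR.refine r F n = HR.refine s F n := by
  ext z
  change HR.refine r F n (QuotientAddGroup.mk z) = HR.refine s F n (QuotientAddGroup.mk z)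
  rw [HR.refine_mk, HR.refine_mk, HR.mk_eq_mk]
  exact Refinement.cochainMap_sub_mem_coboundary h s r F z.1 z.2

lemma HR.refine_trans (r : Refinement 𝒰 𝒱) (s : Refinement 𝒱 𝒲) (x : HR 𝒰 F n) :
    HR.refine s F n (HR.refine r F n x) = HR.refine (r.trans s) F n x := by
  obtain ⟨z, rfl⟩ := QuotientAddGroup.mk_surjective x
  rw [HR.refine_mk, HR.refine_mk, HR.refine_mk]
  congr 1
  exact Subtype.ext (r.cochainMap_trans s F n z.1).symm

/-- The chosen refinements need not compose to the chosen one, nor be the identity on the diagonal;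
both laws hold on cohomology by independence of the refinement. -/
instance : DirectedSystem (fun 𝒰 : CoverSystem X n => HR 𝒰.cover F n)
    fun 𝒰 𝒱 h => transition F n 𝒰 𝒱 h where
  map_self 𝒰 x := by
    change HR.refine _ F n x = x
    rw [HR.refine_eq 𝒰.admissible _ ⟨fun _ j => j, fun _ _ => rfl, fun _ _ => le_rfl⟩]
    obtain ⟨z, rfl⟩ := QuotientAddGroup.mk_surjective x
    rw [HR.refine_mk]
    congr 1
    apply Subtype.ext
    apply Subtype.ext
    funext l
    exact ConcreteCategory.congr_hom ((F.sec n).map_id (op (𝒰.cover.natU n l))) _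
  map_map 𝒰 𝒱 𝒲 h h' x := by
    change HR.refine _ F n (HR.refine _ F n x) = HR.refine _ F n x
    rw [HR.refine_trans, HR.refine_eq 𝒰.admissible]

instance : IsDirectedOrder (CoverSystem X n) where
  directed 𝒰 𝒱 := ⟨⟨_, (𝒰.cover.inter 𝒱.cover).isAdmissible_simplicial n⟩,
    ⟨(𝒰.cover.interLeft 𝒱.cover).trans (RealCover.simplicialRefinement _ _)⟩,
    ⟨(𝒰.cover.interRight 𝒱.cover).trans (RealCover.simplicialRefinement _ _)⟩⟩

instance : Nonempty (CoverSystem X n) := ⟨⟨_, (RealCover.trivial X).isAdmissible_simplicial n⟩⟩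

lemma CechHR.exists_cls (x : CechHR F n) :
    ∃ (𝒰 : CoverSystem X n) (z : cocycle 𝒰.cover.nat F n), CechHR.cls 𝒰 z = x := by
  classical
  refine AddCommGroup.DirectLimit.induction_on (C := fun x : CechHR F n =>
    ∃ (𝒰 : CoverSystem X n) (z : cocycle 𝒰.cover.nat F n), CechHR.cls 𝒰 z = x) x ?_
  intro 𝒰 y
  obtain ⟨z, rfl⟩ := QuotientAddGroup.mk_surjective y
  exact ⟨𝒰, z, rfl⟩

/-- Classes may be computed along any refinement, not only the one selected in `transition`. -/
lemma CechHR.cls_refine {h : 𝒰.IsAdmissible n} {h' : 𝒱.IsAdmissible n} (r : Refinement 𝒰 𝒱)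
    (z : cocycle 𝒰.nat F n) :
    CechHR.cls ⟨𝒱, h'⟩ (r.cocycleMap z) = CechHR.cls ⟨𝒰, h⟩ z := by
  classical
  have hle : (⟨𝒰, h⟩ : CoverSystem X n) ≤ ⟨𝒱, h'⟩ := ⟨r⟩
  have e : transition F n ⟨𝒰, h⟩ ⟨𝒱, h'⟩ hle (QuotientAddGroup.mk z) =
      QuotientAddGroup.mk (r.cocycleMap z) := by
    change HR.refine _ F n _ = _
    rw [HR.refine_eq h' _ r, HR.refine_mk]
  unfold CechHR.cls
  rw [← e]
  exact AddCommGroup.DirectLimit.of_f (f := transition F n) hle _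

lemma CechHR.cls_sub (𝒰 : CoverSystem X n) (z w : cocycle 𝒰.cover.nat F n) :
    CechHR.cls 𝒰 (z - w) = CechHR.cls 𝒰 z - CechHR.cls 𝒰 w :=
  map_sub (CechHR.of F n 𝒰) (QuotientAddGroup.mk z) (QuotientAddGroup.mk w)

lemma CechHR.cls_eq_zero_of_mem (𝒰 : CoverSystem X n) {z : cocycle 𝒰.cover.nat F n}
    (hz : z.1 ∈ coboundary 𝒰.cover.nat F n) : CechHR.cls 𝒰 z = 0 := by
  have : (QuotientAddGroup.mk z : HR 𝒰.cover F n) = 0 :=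
    (QuotientAddGroup.eq_zero_iff z).2 (AddSubgroup.mem_addSubgroupOf.2 hz)
  unfold CechHR.cls
  rw [this, map_zero]

/-- An element of a directed limit vanishes only if it already vanishes at a later stage. -/
lemma CechHR.exists_refinement_of_cls_eq_zero (𝒰 : CoverSystem X n) {z : cocycle 𝒰.cover.nat F n}
    (hz : CechHR.cls 𝒰 z = 0) :
    ∃ (𝒱 : RealCover X) (r : Refinement 𝒰.cover 𝒱),
      r.nat.cochainMap F n z.1 ∈ coboundary 𝒱.nat F n := by
  classical
  obtain ⟨𝒱, h, e⟩ := AddCommGroup.DirectLimit.of.zero_exact (f := transition F n) 𝒰 _ hz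
  refine ⟨𝒱.cover, Classical.choice h, ?_⟩
  exact AddSubgroup.mem_addSubgroupOf.1 ((QuotientAddGroup.eq_zero_iff _).1 e)

lemma RealPresheaf.Hom.mapCech_cls (φ : F.Hom G) (𝒰 : CoverSystem X n)
    (z : cocycle 𝒰.cover.nat F n) :
    φ.mapCech n (CechHR.cls 𝒰 z) = CechHR.cls 𝒰 (φ.cocycleMap z) := by
  classical
  exact AddCommGroup.DirectLimit.map_apply_of (f := transition F n) (f' := transition G n)
    (fun 𝒰 : CoverSystem X n => φ.mapHR 𝒰.cover n) (φ.mapHR_transition n) _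

end classes

/-! ### The long exact sequence -/

/-- A sequence `0 ⟶ F' ⟶ F ⟶ F'' ⟶ 0` is Čech exact if it is left exact on sections and cochains
with values in `F''` lift to `F` after a refinement. -/
structure CechShortExact {F' F F'' : RealPresheaf X} (φ' : F'.Hom F) (φ : F.Hom F'') : Prop where
  injective : ∀ n (U : Opens (X.space n)), Function.Injective ((φ'.app n).app (op U))
  exact : ∀ n (U : Opens (X.space n)),
    Function.Exact ((φ'.app n).app (op U)) ((φ.app n).app (op U))
  lift : ∀ (𝒰 : RealCover X) (n : ℕ) (c : cochain 𝒰.nat F'' n),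
    ∃ (𝒱 : RealCover X) (r : Refinement 𝒰 𝒱) (b : cochain 𝒱.nat F n),
      φ.cochainMap 𝒱.nat n b = r.nat.cochainMap F'' n c

variable {F' F F'' : RealPresheaf X} {φ' : F'.Hom F} {φ : F.Hom F''}

namespace CechShortExact

variable (H : CechShortExact φ' φ) {n : ℕ} {𝒰 : RealCover X}
include H

lemma cochainMap_injective : Function.Injective (φ'.cochainMap 𝒰.nat n) := by
  intro a b h
  apply Subtype.ext
  funext l
  exact H.injective n _ (congrFun (congrArg Subtype.val h) l)

lemma cochainMap_exact :
    Function.Exact (φ'.cochainMap 𝒰.nat n) (φ.cochainMap 𝒰.nat n) := by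
  intro c
  constructor
  · intro h
    choose s hs using fun l => (H.exact n _ (c.1 l)).1 (congrFun (congrArg Subtype.val h) l)
    refine ⟨⟨s, fun l => ?_⟩, Subtype.ext (funext hs)⟩
    -- The preimage is Real because its image is and `φ'` is injective and commutes with `σ`.
    apply H.injective n
    rw [hs, c.2 l, ← hs l]
    exact (ConcreteCategory.congr_hom (φ'.σ_app n _ _ (𝒰.nat.U_bar n l)) (s l)).symm
  · rintro ⟨b, rfl⟩
    apply Subtype.ext
    funext l
    exact (H.exact n _ _).2 ⟨b.1 l, rfl⟩

lemma cocycleMap_exact (z : cocycle 𝒰.nat F n) (h : φ.cochainMap 𝒰.nat n z.1 = 0) :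
    ∃ z' : cocycle 𝒰.nat F' n, φ'.cocycleMap z' = z := by
  obtain ⟨c, hc⟩ := (H.cochainMap_exact z.1).1 h
  refine ⟨⟨c, ?_⟩, Subtype.ext hc⟩
  apply H.cochainMap_injective
  rw [map_zero, ← φ'.d_cochainMap, hc]
  exact z.2

lemma lift_admissible (c : cochain 𝒰.nat F'' n) (m : ℕ) :
    ∃ (𝒱 : RealCover X) (_ : 𝒱.IsAdmissible m) (r : Refinement 𝒰 𝒱) (b : cochain 𝒱.nat F n),
      φ.cochainMap 𝒱.nat n b = r.nat.cochainMap F'' n c := by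
  obtain ⟨𝒱, r, b, hb⟩ := H.lift 𝒰 n c
  let s := 𝒱.simplicialRefinement (m + 1)
  refine ⟨_, 𝒱.isAdmissible_simplicial m, r.trans s, s.nat.cochainMap F n b, ?_⟩
  rw [φ.cochainMap_refine, hb, r.cochainMap_trans]

/-- If the image of a cochain in `F''` is a coboundary then after a refinement the cochain differs
by a coboundary from one with values in `F'`. -/
lemma exists_sub_mem_coboundary (c : cochain 𝒰.nat F n)
    (hc : φ.cochainMap 𝒰.nat n c ∈ coboundary 𝒰.nat F'' n) (m : ℕ) :
    ∃ (𝒱 : RealCover X) (_ : 𝒱.IsAdmissible m) (r : Refinement 𝒰 𝒱) (c' : cochain 𝒱.nat F' n),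
      r.nat.cochainMap F n c - φ'.cochainMap 𝒱.nat n c' ∈ coboundary 𝒱.nat F n := by
  cases n with
  | zero =>
    let s := 𝒰.simplicialRefinement (m + 1)
    -- In degree zero the hypothesis says that the image vanishes, so `c` already comes from `F'`
    -- over `𝒰`; refining only secures admissibility.
    obtain ⟨c', rfl⟩ := (H.cochainMap_exact c).1 hc
    refine ⟨_, 𝒰.isAdmissible_simplicial m, s, s.nat.cochainMap F' 0 c', ?_⟩
    rw [φ'.cochainMap_refine, sub_self]
    exact zero_mem _
  | succ n =>
    obtain ⟨b'', hb''⟩ := hc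
    obtain ⟨𝒱, h, r, b, hb⟩ := H.lift_admissible b'' m
    -- With `b` lifting a primitive of the image of `c`, the cochain `c - db` is killed by `φ`.
    obtain ⟨c', hc'⟩ := (H.cochainMap_exact
      (r.nat.cochainMap F (n + 1) c - d 𝒱.nat F n b)).1 (by
        rw [map_sub, φ.cochainMap_refine, ← φ.d_cochainMap, hb, r.nat.d_cochainMap, hb'', sub_self])
    exact ⟨𝒱, h, r, c', b, by rw [hc', sub_sub_cancel]⟩

end CechShortExact

/-- The relation whose graph is the connecting homomorphism. -/
def IsConnecting (φ' : F'.Hom F) (φ : F.Hom F'') (n : ℕ) (x : CechHR F'' n)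
    (y : CechHR F' (n + 1)) : Prop :=
  ∃ (𝒰 : RealCover X) (h : 𝒰.IsAdmissible n) (h' : 𝒰.IsAdmissible (n + 1))
    (c : cochain 𝒰.nat F n) (z : cocycle 𝒰.nat F'' n) (z' : cocycle 𝒰.nat F' (n + 1)),
    φ.cochainMap 𝒰.nat n c = z.1 ∧ φ'.cochainMap 𝒰.nat (n + 1) z'.1 = d 𝒰.nat F n c ∧
      CechHR.cls ⟨𝒰, h⟩ z = x ∧ CechHR.cls ⟨𝒰, h'⟩ z' = y

lemma Refinement.connecting {𝒰 𝒱 : RealCover X} {n : ℕ} (r : Refinement 𝒰 𝒱)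
    {c : cochain 𝒰.nat F n} {z : cocycle 𝒰.nat F'' n} {z' : cocycle 𝒰.nat F' (n + 1)}
    (hz : φ.cochainMap 𝒰.nat n c = z.1)
    (hz' : φ'.cochainMap 𝒰.nat (n + 1) z'.1 = d 𝒰.nat F n c) :
    φ.cochainMap 𝒱.nat n (r.nat.cochainMap F n c) = (r.cocycleMap z).1 ∧
      φ'.cochainMap 𝒱.nat (n + 1) (r.cocycleMap z').1 =
        d 𝒱.nat F n (r.nat.cochainMap F n c) := by
  rw [φ.cochainMap_refine, hz, r.coe_cocycleMap z', φ'.cochainMap_refine, hz',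
    r.nat.d_cochainMap]
  exact ⟨rfl, rfl⟩

/-- Both sets of data are restricted to one common refinement admissible in degrees `n` and `n + 1`,
where they are subtracted. -/
lemma IsConnecting.sub {n : ℕ} {x₁ x₂ : CechHR F'' n} {y₁ y₂ : CechHR F' (n + 1)}
    (h₁ : IsConnecting φ' φ n x₁ y₁) (h₂ : IsConnecting φ' φ n x₂ y₂) :
    IsConnecting φ' φ n (x₁ - x₂) (y₁ - y₂) := by
  obtain ⟨𝒰₁, h₁, h₁', c₁, z₁, z₁', hz₁, hz₁', rfl, rfl⟩ := h₁
  obtain ⟨𝒰₂, h₂, h₂', c₂, z₂, z₂', hz₂, hz₂', rfl, rfl⟩ := h₂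
  have h' := (𝒰₁.inter 𝒰₂).isAdmissible_simplicial (n + 1)
  let r₁ := (𝒰₁.interLeft 𝒰₂).trans (RealCover.simplicialRefinement _ (n + 1 + 1))
  let r₂ := (𝒰₁.interRight 𝒰₂).trans (RealCover.simplicialRefinement _ (n + 1 + 1))
  obtain ⟨e₁, e₁'⟩ := r₁.connecting hz₁ hz₁'
  obtain ⟨e₂, e₂'⟩ := r₂.connecting hz₂ hz₂'
  refine ⟨_, h'.of_succ, h', r₁.nat.cochainMap F n c₁ - r₂.nat.cochainMap F n c₂,
    r₁.cocycleMap z₁ - r₂.cocycleMap z₂, r₁.cocycleMap z₁' - r₂.cocycleMap z₂', ?_, ?_, ?_, ?_⟩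
  · rw [map_sub, e₁, e₂]
    rfl
  · rw [map_sub, ← e₁', ← e₂', ← map_sub]
    rfl
  · rw [CechHR.cls_sub, CechHR.cls_refine (h := h₁), CechHR.cls_refine (h := h₂)]
  · rw [CechHR.cls_sub, CechHR.cls_refine (h := h₁'), CechHR.cls_refine (h := h₂')]

namespace CechShortExact

variable (H : CechShortExact φ' φ) {n : ℕ}
include H

/-- If `c` lifts the cocycle `z`, then `dc` maps to `dz = 0` and so comes from a cocycle in `F'`.
The lift is taken over a cover admissible in degree `n + 1`, hence also in degree `n`. -/
lemma exists_isConnecting (x : CechHR F'' n) : ∃ y, IsConnecting φ' φ n x y := by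
  obtain ⟨𝒰, z, rfl⟩ := CechHR.exists_cls x
  obtain ⟨𝒱, h, r, c, hc⟩ := H.lift_admissible z.1 (n + 1)
  obtain ⟨z', hz'⟩ := H.cocycleMap_exact ⟨d 𝒱.nat F n c, d_d _ _ _ _⟩ (by
    rw [← φ.d_cochainMap, hc, r.nat.d_cochainMap, show d 𝒰.cover.nat F'' n z.1 = 0 from z.2,
      map_zero])
  exact ⟨_, 𝒱, h.of_succ, h, c, r.cocycleMap z, z', hc, congrArg Subtype.val hz',
    CechHR.cls_refine r z, rfl⟩

/-- After refinement `c` differs from some `φ'(c')` by a coboundary, so `dc = φ'(dc')`, and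
injectivity of `φ'` gives `z' = dc'`. -/
lemma eq_zero_of_isConnecting {y : CechHR F' (n + 1)} (h : IsConnecting φ' φ n 0 y) : y = 0 := by
  obtain ⟨𝒰, h, h', c, z, z', hz, hz', hx, rfl⟩ := h
  obtain ⟨𝒱, r, hr⟩ := CechHR.exists_refinement_of_cls_eq_zero _ hx
  rw [← hz, ← φ.cochainMap_refine] at hr
  obtain ⟨𝒲, h₂, s, c', hc'⟩ := H.exists_sub_mem_coboundary _ hr (n + 1)
  rw [← CechHR.cls_refine (h' := h₂) (r.trans s)]
  apply CechHR.cls_eq_zero_of_mem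
  refine ⟨c', H.cochainMap_injective ?_⟩
  have e := coboundary_le_cocycle _ hc'
  rw [AddMonoidHom.mem_ker, map_sub, sub_eq_zero] at e
  rw [← φ'.d_cochainMap, ← e, ((r.trans s).connecting hz hz').2, r.cochainMap_trans]

lemma isConnecting_unique {x : CechHR F'' n} {y₁ y₂ : CechHR F' (n + 1)}
    (h₁ : IsConnecting φ' φ n x y₁) (h₂ : IsConnecting φ' φ n x y₂) : y₁ = y₂ := by
  have h := h₁.sub h₂
  rw [sub_self] at h
  exact sub_eq_zero.1 (H.eq_zero_of_isConnecting h)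

lemma exists_connecting (n : ℕ) :
    ∃ bd : CechHR F'' n →+ CechHR F' (n + 1), ∀ x y, bd x = y ↔ IsConnecting φ' φ n x y := by
  choose f hf using H.exists_isConnecting (n := n)
  have key : ∀ x y, f x = y ↔ IsConnecting φ' φ n x y :=
    fun x y => ⟨fun h => h ▸ hf x, H.isConnecting_unique (hf x)⟩
  refine ⟨AddMonoidHom.ofMapSub f fun x y => ?_, key⟩
  rw [key]
  exact (hf x).sub (hf y)

lemma mapCech_zero_injective : Function.Injective (φ'.mapCech 0) := by
  rw [injective_iff_map_eq_zero]
  intro x hx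
  obtain ⟨𝒰, z, rfl⟩ := CechHR.exists_cls x
  rw [φ'.mapCech_cls] at hx
  obtain ⟨𝒱, r, hr⟩ := CechHR.exists_refinement_of_cls_eq_zero _ hx
  let s := 𝒱.simplicialRefinement 1
  rw [← CechHR.cls_refine (h' := 𝒱.isAdmissible_simplicial 0) (r.trans s)]
  apply CechHR.cls_eq_zero_of_mem
  apply H.cochainMap_injective
  have e : φ'.cochainMap 𝒱.nat 0 (r.nat.cochainMap F' 0 z.1) = 0 :=
    (φ'.cochainMap_refine r 0 z.1).trans hr
  rw [Refinement.coe_cocycleMap, r.cochainMap_trans, φ'.cochainMap_refine, e, map_zero, map_zero]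

lemma mapCech_exact : Function.Exact (φ'.mapCech n) (φ.mapCech n) := by
  intro x
  constructor
  · intro hx
    obtain ⟨𝒰, z, rfl⟩ := CechHR.exists_cls x
    rw [φ.mapCech_cls] at hx
    obtain ⟨𝒱, r, hr⟩ := CechHR.exists_refinement_of_cls_eq_zero _ hx
    obtain ⟨𝒲, h, s, c', hc'⟩ := H.exists_sub_mem_coboundary (r.nat.cochainMap F n z.1)
      (by rw [φ.cochainMap_refine]; exact hr) n
    -- The cochain `φ'(c')` differs from a cocycle by a coboundary, and `φ'` is injective.
    have hz : d 𝒲.nat F' n c' = 0 := by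
      apply H.cochainMap_injective
      have e := coboundary_le_cocycle _ hc'
      rw [AddMonoidHom.mem_ker, map_sub, sub_eq_zero] at e
      rw [map_zero, ← φ'.d_cochainMap, ← e, ← r.cochainMap_trans]
      exact ((r.trans s).cocycleMap z).2
    refine ⟨CechHR.cls ⟨𝒲, h⟩ ⟨c', hz⟩, ?_⟩
    rw [φ'.mapCech_cls, ← CechHR.cls_refine (h' := h) (r.trans s), eq_comm, ← sub_eq_zero,
      ← CechHR.cls_sub]
    apply CechHR.cls_eq_zero_of_mem
    rw [← r.cochainMap_trans] at hc'
    exact hc'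
  · rintro ⟨x, rfl⟩
    obtain ⟨𝒰, z, rfl⟩ := CechHR.exists_cls x
    rw [φ'.mapCech_cls, φ.mapCech_cls]
    apply CechHR.cls_eq_zero_of_mem
    have e : φ.cochainMap 𝒰.cover.nat n (φ'.cochainMap 𝒰.cover.nat n z.1) = 0 :=
      (H.cochainMap_exact _).2 ⟨_, rfl⟩
    change φ.cochainMap 𝒰.cover.nat n (φ'.cochainMap 𝒰.cover.nat n z.1) ∈ _
    rw [e]
    exact zero_mem _

lemma isConnecting_zero_iff (x : CechHR F'' n) :
    IsConnecting φ' φ n x 0 ↔ x ∈ Set.range (φ.mapCech n) := by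
  constructor
  · rintro ⟨𝒰, h, h', c, z, z', hz, hz', rfl, hy⟩
    obtain ⟨𝒱, r, b, hb⟩ := CechHR.exists_refinement_of_cls_eq_zero _ hy
    let s := 𝒱.simplicialRefinement (n + 1)
    obtain ⟨e, e'⟩ := (r.trans s).connecting hz hz'
    -- If `z' = db` after refinement, then `c - φ'(b)` is a cocycle with the same image as `c`.
    refine ⟨CechHR.cls ⟨_, 𝒱.isAdmissible_simplicial n⟩ ⟨(r.trans s).nat.cochainMap F n c -
      φ'.cochainMap _ n (s.nat.cochainMap F' n b), ?_⟩, ?_⟩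
    · rw [AddMonoidHom.mem_ker, map_sub, sub_eq_zero, ← e', φ'.d_cochainMap, s.nat.d_cochainMap,
        hb, Refinement.coe_cocycleMap, r.cochainMap_trans]
    · rw [φ.mapCech_cls, ← CechHR.cls_refine (h' := 𝒱.isAdmissible_simplicial n) (r.trans s)]
      congr 1
      apply Subtype.ext
      change φ.cochainMap _ n (_ - _) = _
      rw [map_sub, e, (H.cochainMap_exact _).2 ⟨_, rfl⟩, sub_zero]
  · rintro ⟨x, rfl⟩
    obtain ⟨𝒰, z, rfl⟩ := CechHR.exists_cls x
    let s := 𝒰.cover.simplicialRefinement (n + 2)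
    have h' := 𝒰.cover.isAdmissible_simplicial (n + 1)
    refine ⟨_, h'.of_succ, h', (s.cocycleMap z).1, φ.cocycleMap (s.cocycleMap z), 0, rfl, ?_, ?_, ?_⟩
    · rw [show d _ F n (s.cocycleMap z).1 = 0 from (s.cocycleMap z).2]
      exact map_zero _
    · rw [← φ.mapCech_cls ⟨_, h'.of_succ⟩, CechHR.cls_refine (h := 𝒰.admissible)]
    · exact CechHR.cls_eq_zero_of_mem _ (zero_mem _)

/-- If `φ'(z')` becomes `dc` after refinement, then `φ(c)` is a cocycle whose class has the class of
`z'` as its connecting image. -/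
lemma exists_isConnecting_iff (y : CechHR F' (n + 1)) :
    (∃ x, IsConnecting φ' φ n x y) ↔ φ'.mapCech (n + 1) y = 0 := by
  constructor
  · rintro ⟨x, 𝒰, h, h', c, z, z', hz, hz', rfl, rfl⟩
    rw [φ'.mapCech_cls]
    exact CechHR.cls_eq_zero_of_mem _ ⟨c, hz'.symm⟩
  · intro hy
    obtain ⟨𝒰, z, rfl⟩ := CechHR.exists_cls y
    rw [φ'.mapCech_cls] at hy
    obtain ⟨𝒱, r, c, hc⟩ := CechHR.exists_refinement_of_cls_eq_zero _ hy
    have hc' : d 𝒱.nat F n c = φ'.cochainMap 𝒱.nat (n + 1) (r.cocycleMap z).1 :=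
      hc.trans (φ'.cochainMap_refine r (n + 1) z.1).symm
    have hd : d 𝒱.nat F'' n (φ.cochainMap 𝒱.nat n c) = 0 := by
      rw [φ.d_cochainMap, hc']
      exact (H.cochainMap_exact _).2 ⟨_, rfl⟩
    let s := 𝒱.simplicialRefinement (n + 2)
    have h' := 𝒱.isAdmissible_simplicial (n + 1)
    obtain ⟨e, e'⟩ := s.connecting (φ := φ) (z := ⟨_, hd⟩) rfl hc'.symm
    refine ⟨_, _, h'.of_succ, h', _, _, _, e, e', rfl, ?_⟩
    have e₂ : s.cocycleMap (r.cocycleMap z) = (r.trans s).cocycleMap z :=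
      Subtype.ext (r.cochainMap_trans s F' _ z.1).symm
    rw [e₂]
    exact CechHR.cls_refine (h := 𝒰.admissible) (r.trans s) z

end CechShortExact

/-! ### Exactness on stalks and on sections -/

section stalks

open TopCat.Presheaf

variable {Y : TopCat.{u}} {F G H : Y.Presheaf AddCommGrpCat.{u}}

lemma map_map_apply {U V W : Opens Y} (h : V ≤ U) (h' : W ≤ V) (h'' : W ≤ U)
    (s : F.obj (op U)) :
    F.map (homOfLE h').op (F.map (homOfLE h).op s) = F.map (homOfLE h'').op s :=
  (ConcreteCategory.congr_hom (F.map_comp (homOfLE h).op (homOfLE h').op) s).symm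

lemma app_map_apply (f : F ⟶ G) {U V : Opens Y} (h : V ≤ U) (s : F.obj (op U)) :
    f.app (op V) (F.map (homOfLE h).op s) = G.map (homOfLE h).op (f.app (op U) s) :=
  ConcreteCategory.congr_hom (f.naturality (homOfLE h).op) s

lemma exists_local_lift (f : F ⟶ G) {U : Opens Y} {x : Y} (hx : x ∈ U) (s : G.obj (op U))
    (h : G.germ U x hx s ∈ Set.range ((stalkFunctor AddCommGrpCat.{u} x).map f)) :
    ∃ (V : Opens Y) (hV : V ≤ U), x ∈ V ∧
      ∃ t : F.obj (op V), f.app (op V) t = G.map (homOfLE hV).op s := by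
  obtain ⟨t, ht⟩ := h
  obtain ⟨V, hV, t, rfl⟩ := F.exists_germ_eq t
  rw [stalkFunctor_map_germ_apply] at ht
  obtain ⟨W, hW, i, j, e⟩ := G.germ_eq x hV hx _ _ ht
  exact ⟨W, j.le, hW, F.map (homOfLE i.le).op t, (app_map_apply f i.le t).trans e⟩

/-- A section killed by `g` has local preimages by stalk exactness; they agree on overlaps because
`f` is injective on sections, and therefore glue. -/
lemma exact_app_of_exact_stalk (hF : F.IsSheaf) (hG : G.IsSheaf) (hH : H.IsSheaf)
    (f : F ⟶ G) (g : G ⟶ H)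
    (hf : ∀ U : Opens Y, Function.Injective (f.app (op U)))
    (h : ∀ x, Function.Exact ((stalkFunctor AddCommGrpCat.{u} x).map f)
      ((stalkFunctor AddCommGrpCat.{u} x).map g)) (U : Opens Y) :
    Function.Exact (f.app (op U)) (g.app (op U)) := by
  intro s
  constructor
  · intro hs
    have local_lift : ∀ x : U, ∃ (V : Opens Y) (hV : V ≤ U), x.1 ∈ V ∧
        ∃ t : F.obj (op V), f.app (op V) t = G.map (homOfLE hV).op s := by
      intro x
      refine exists_local_lift f x.2 s ((h x.1 _).1 ?_)
      rw [stalkFunctor_map_germ_apply, hs]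
      exact map_zero _
    choose V hV hxV t ht using local_lift
    have hcover : U ≤ iSup V := fun x hx => Opens.mem_iSup.2 ⟨⟨x, hx⟩, hxV _⟩
    obtain ⟨r, hr, -⟩ := TopCat.Sheaf.existsUnique_gluing' (⟨F, hF⟩ : TopCat.Sheaf _ Y) V U
      (fun x => homOfLE (hV x)) hcover t (by
        intro x y
        apply hf
        refine (app_map_apply f inf_le_left (t x)).trans (Eq.trans ?_
          (app_map_apply f inf_le_right (t y)).symm)
        rw [ht, ht, map_map_apply _ _ (inf_le_left.trans (hV x)),
          map_map_apply _ _ (inf_le_left.trans (hV x))])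
    refine ⟨r, TopCat.Sheaf.eq_of_locally_eq' (⟨G, hG⟩ : TopCat.Sheaf _ Y) V U
      (fun x => homOfLE (hV x)) hcover _ _ fun x => ?_⟩
    refine (app_map_apply f (hV x) r).symm.trans (Eq.trans ?_ (ht x))
    exact congrArg _ (hr x)
  · rintro ⟨r, rfl⟩
    refine TopCat.Presheaf.section_ext (⟨H, hH⟩ : TopCat.Sheaf _ Y) U _ _ fun x hx => ?_
    change H.germ U x hx _ = H.germ U x hx 0
    rw [← stalkFunctor_map_germ_apply, ← stalkFunctor_map_germ_apply]
    exact ((h x _).2 ⟨_, rfl⟩).trans (map_zero _).symm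

lemma eq_of_isSheaf_of_empty (hF : F.IsSheaf) {U : Opens Y} (hU : ∀ x, x ∉ U)
    (s t : F.obj (op U)) : s = t :=
  TopCat.Presheaf.section_ext (⟨F, hF⟩ : TopCat.Sheaf _ Y) U s t fun x hx => (hU x hx).elim

end stalks

/-! ### Lifting cochains -/

/-- If the involution on the indices is free, then a Real cochain lifts as soon as its components at
representatives of the orbits do. -/
lemma exists_lift_of_sign {F F'' : RealPresheaf X} (φ : F.Hom F'') {𝒱 : RealCover X} {n : ℕ}
    (sign : 𝒱.J n → Bool) (hsign : ∀ j, sign (𝒱.bar n j) = !sign j) (c : cochain 𝒱.nat F'' n)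
    (h : ∀ l : 𝒱.Λ n, sign (l n (Inc.id n)) = true →
      ∃ s : (F.sec n).obj (op (𝒱.natU n l)), (φ.app n).app (op (𝒱.natU n l)) s = c.1 l) :
    ∃ b : cochain 𝒱.nat F n, φ.cochainMap 𝒱.nat n b = c := by
  choose s hs using h
  have bar_bar : ∀ l : 𝒱.Λ n, 𝒱.nat.bar n (𝒱.nat.bar n l) = l := 𝒱.nat.bar_bar n
  have conj_bar : ∀ l : 𝒱.Λ n, 𝒱.natU n l = X.conj (𝒱.natU n (𝒱.nat.bar n l)) := fun l => by
    conv_lhs => rw [← bar_bar l]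
    exact 𝒱.nat.U_bar n (𝒱.nat.bar n l)
  have sign_bar : ∀ l : 𝒱.Λ n, sign (𝒱.nat.bar n l n (Inc.id n)) = !sign (l n (Inc.id n)) :=
    fun _ => hsign _
  have sign_bar' : ∀ l : 𝒱.Λ n, ¬ sign (l n (Inc.id n)) = true →
      sign (𝒱.nat.bar n l n (Inc.id n)) = true := fun l h => by
    rw [sign_bar]
    simpa using h
  -- The sign of the component at the identity picks exactly one index from each orbit; the value at
  -- the other is forced by conjugation.
  let b : ∀ l : 𝒱.Λ n, (F.sec n).obj (op (𝒱.natU n l)) := fun l =>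
    if h : sign (l n (Inc.id n)) = true then s l h
    else F.σ n _ _ (conj_bar l) (s (𝒱.nat.bar n l) (sign_bar' l h))
  have b_true : ∀ l (h : sign (l n (Inc.id n)) = true), b l = s l h := fun l h => dif_pos h
  have b_false : ∀ l (h : ¬ sign (l n (Inc.id n)) = true),
      b l = F.σ n _ _ (conj_bar l) (s (𝒱.nat.bar n l) (sign_bar' l h)) := fun l h => dif_neg h
  refine ⟨⟨b, ?_⟩, ?_⟩
  · intro (l : 𝒱.Λ n)
    by_cases h : sign (l n (Inc.id n)) = true
    · have h' : ¬ sign (𝒱.nat.bar n l n (Inc.id n)) = true := fun h' => by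
        simpa [h] using (sign_bar l).symm.trans h'
      have key : ∀ (a : 𝒱.Λ n) (_ : a = l) (ha : sign (a n (Inc.id n)) = true)
          (e : 𝒱.natU n (𝒱.nat.bar n l) = X.conj (𝒱.natU n a)),
          F.σ n (𝒱.natU n a) (𝒱.natU n (𝒱.nat.bar n l)) e (s a ha) =
            F.σ n _ _ (𝒱.nat.U_bar n l) (b l) := by
        rintro a rfl ha e
        rw [b_true a ha]
        rfl
      rw [b_false _ h']
      exact key _ (bar_bar l) _ _
    · rw [b_true _ (sign_bar' l h), b_false l h]
      exact (ConcreteCategory.congr_hom (F.σ_σ n _ _ (conj_bar l) (𝒱.nat.U_bar n l)) _).symm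
  · apply Subtype.ext
    refine funext fun (l : 𝒱.Λ n) => ?_
    change (φ.app n).app (op (𝒱.natU n l)) (b l) = c.1 l
    by_cases h : sign (l n (Inc.id n)) = true
    · rw [b_true l h, hs]
    · rw [b_false l h]
      refine (ConcreteCategory.congr_hom (φ.σ_app n _ _ (conj_bar l)) _).trans ?_
      refine (congrArg (F''.σ n _ _ (conj_bar l))
        ((hs _ (sign_bar' l h)).trans (c.2 l))).trans ?_
      exact ConcreteCategory.congr_hom (F''.σ_σ n _ _ (𝒱.nat.U_bar n l) (conj_bar l)) _

/-- Sections lift over every open set, so the only obstacle is equivariance, removed by listing each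
member of `𝒰` and its conjugate under distinct indices. -/
lemma PresheafShortExact.cechShortExact {F' F F'' : RealPresheaf X} {φ' : F'.Hom F}
    {φ : F.Hom F''} (h : PresheafShortExact φ' φ) : CechShortExact φ' φ where
  injective n U := (h n U).1
  exact n U := (h n U).2.1
  lift 𝒰 n c := by
    let r : Refinement 𝒰 (RealCover.double 𝒰.J 𝒰.U 𝒰.covers) :=
      RealCover.doubleRefinement (fun _ j => j) fun _ _ => le_rfl
    exact ⟨_, r, exists_lift_of_sign φ (𝒱 := RealCover.double _ _ _) Prod.snd (fun _ => rfl)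
      (r.nat.cochainMap F'' n c) fun l _ => (h n _).2.2 _⟩

/-! ### The sheaf case -/

/-- A Real cover of paracompact Hausdorff spaces can be shrunk to a locally finite Real family of
closed sets whose interiors cover. -/
lemma RealCover.exists_closed_shrinking (𝒰 : RealCover X) (n : ℕ) [T2Space (X.space n)]
    [ParacompactSpace (X.space n)] :
    ∃ L : 𝒰.J n → Set (X.space n), (∀ j, IsClosed (L j)) ∧ LocallyFinite L ∧
      (∀ j, L j ⊆ 𝒰.U n j) ∧ (∀ j x, x ∈ L j → X.inv n x ∈ L (𝒰.bar n j)) ∧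
      ∀ x, ∃ j, L j ∈ nhds x := by
  obtain ⟨v, vo, vc, vf, vU⟩ := precise_refinement (fun j => (𝒰.U n j : Set (X.space n)))
    (fun j => (𝒰.U n j).isOpen) (Set.eq_univ_of_forall fun x =>
      Set.mem_iUnion.2 (𝒰.covers n x))
  obtain ⟨w, wc, wo, wv⟩ := exists_iUnion_eq_closure_subset vo vf.point_finite vc
  have hinv : Continuous (X.inv n) := (X.inv n).hom.continuous
  let K : 𝒰.J n → Set (X.space n) := fun j => closure (w j)
  have hK : LocallyFinite K := vf.subset wv
  have hK' : LocallyFinite fun j => (X.inv n) ⁻¹' (K (𝒰.bar n j)) :=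
    (hK.preimage_continuous hinv).comp_injective
      (Function.LeftInverse.injective (𝒰.bar_bar n))
  -- Adding the conjugate of the set with conjugate index makes the family Real, and keeps it
  -- closed, locally finite and inside the `𝒰.U n j`.
  refine ⟨fun j => K j ∪ (X.inv n) ⁻¹' (K (𝒰.bar n j)), fun j =>
    isClosed_closure.union (isClosed_closure.preimage hinv), fun x => ?_, fun j => ?_, ?_,
    fun x => ?_⟩
  · obtain ⟨s, hs, hs'⟩ := hK x
    obtain ⟨t, ht, ht'⟩ := hK' x
    refine ⟨s ∩ t, Filter.inter_mem hs ht, (hs'.union ht').subset ?_⟩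
    rintro j ⟨y, hy | hy, hys, hyt⟩
    · exact Or.inl ⟨y, hy, hys⟩
    · exact Or.inr ⟨y, hy, hyt⟩
  · rintro x (hx | hx)
    · exact vU j (wv j hx)
    · have h := vU _ (wv _ hx)
      rw [SetLike.mem_coe, 𝒰.mem_bar, X.inv_inv] at h
      exact h
  · rintro j x (hx | hx)
    · right
      change X.inv n (X.inv n x) ∈ K (𝒰.bar n (𝒰.bar n j))
      rwa [X.inv_inv, 𝒰.bar_bar]
    · exact Or.inl hx
  · obtain ⟨j, hj⟩ := Set.mem_iUnion.1 (wc.symm ▸ Set.mem_univ x : x ∈ ⋃ j, w j)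
    exact ⟨j, Filter.mem_of_superset ((wo j).mem_nhds hj)
      (subset_closure.trans Set.subset_union_left)⟩

lemma RealCover.finite_setOf_forall_mem (𝒰 : RealCover X) (n : ℕ)
    (T : ∀ k, Inc k n → Set (𝒰.J k)) (hT : ∀ k φ, (T k φ).Finite) :
    {l | ∀ k φ, (l : 𝒰.Λ n) k φ ∈ T k φ}.Finite := by
  have h := Set.Finite.pi' (fun p : (Σ k : ℕ, Inc k n) => hT p.1 p.2)
  refine (h.preimage (f := fun (l : 𝒰.Λ n) (p : (Σ k : ℕ, Inc k n)) => l p.1 p.2) ?_).subset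
    fun l hl p => hl p.1 p.2
  intro l _ l' _ e
  funext k φ
  exact congrFun e ⟨k, φ⟩

section sheaf

variable {F F'' : RealPresheaf X} (φ : F.Hom F'')

/-- Local surjectivity of a morphism of Real presheaves. -/
def LocallySurjective : Prop :=
  ∀ (n : ℕ) (U : Opens (X.space n)) (s : (F''.sec n).obj (op U)) (x : X.space n), x ∈ U →
    ∃ (V : Opens (X.space n)) (hV : V ≤ U), x ∈ V ∧ ∃ t : (F.sec n).obj (op V),
      (φ.app n).app (op V) t = (F''.sec n).map (homOfLE hV).op s

variable {φ}

/-- The point of the lemma is that `N` does not depend on `l` or `W`. Only the finitely many `l`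
whose sets `L` contain all faces of `x` can matter near `x`; for each a local lift is chosen, and
`N` lies in all their domains. -/
lemma LocallySurjective.exists_nhd (hφ : LocallySurjective φ) (hF'' : F''.IsRealSheaf)
    {𝒰 : RealCover X} {L : ∀ n, 𝒰.J n → Set (X.space n)} (hLc : ∀ n j, IsClosed (L n j))
    (hLf : ∀ n, LocallyFinite (L n)) (hLU : ∀ n j, L n j ⊆ 𝒰.U n j)
    (hLx : ∀ n x, ∃ j, L n j ∈ nhds x) {n : ℕ} (c : cochain 𝒰.nat F'' n) (x : X.space n) :
    ∃ N : Opens (X.space n), x ∈ N ∧ (∃ j, (N : Set (X.space n)) ⊆ L n j) ∧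
      ∀ (l : 𝒰.Λ n) (W : Opens (X.space n)) (hW : W ≤ 𝒰.natU n l), W ≤ N →
        (∀ y ∈ W, ∀ k (f : Inc k n), X.face f.1 y ∈ L k (l k f)) →
        ∃ s : (F.sec n).obj (op W),
          (φ.app n).app (op W) s = (F''.sec n).map (homOfLE hW).op (c.1 l) := by
  obtain ⟨j, hj⟩ := hLx n x
  let T : ∀ k, Inc k n → Set (𝒰.J k) := fun k f => {j | X.face f.1 x ∈ L k j}
  have hfin : {l | ∀ k f, (l : 𝒰.Λ n) k f ∈ T k f}.Finite :=
    𝒰.finite_setOf_forall_mem n T fun k f => (hLf k).point_finite _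
  have hloc : ∀ l : 𝒰.Λ n, ∃ V : Opens (X.space n), x ∈ V ∧ ((∀ k f, l k f ∈ T k f) →
      ∃ (hV : V ≤ 𝒰.natU n l) (t : (F.sec n).obj (op V)),
        (φ.app n).app (op V) t = (F''.sec n).map (homOfLE hV).op (c.1 l)) := by
    intro l
    by_cases hl : ∀ k f, l k f ∈ T k f
    · obtain ⟨V, hV, hx, t, ht⟩ := hφ n (𝒰.natU n l) (c.1 l) x fun k f => hLU k _ (hl k f)
      exact ⟨V, hx, fun _ => ⟨hV, t, ht⟩⟩
    · exact ⟨⊤, trivial, fun h => (hl h).elim⟩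
  choose V hxV hV using hloc
  have h₁ : ∀ᶠ y in nhds x, ∀ l ∈ {l | ∀ k f, (l : 𝒰.Λ n) k f ∈ T k f}, y ∈ V l :=
    (Filter.eventually_all_finite hfin).2 fun l _ => (V l).isOpen.mem_nhds (hxV l)
  -- A locally finite family of closed sets acquires no new members near a point.
  have h₂ : ∀ᶠ y in nhds x, ∀ p : (Σ k : ℕ, Inc k n), ∀ j, X.face p.2.1 y ∈ L p.1 j →
      X.face p.2.1 x ∈ L p.1 j :=
    Filter.eventually_all.2 fun p => ((X.face p.2.1).hom.continuous.tendsto x).eventually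
      ((hLf p.1).eventually_subset (hLc p.1) (X.face p.2.1 x))
  obtain ⟨N, hN, hNo, hxN⟩ := mem_nhds_iff.1 (Filter.inter_mem hj (h₁.and h₂))
  refine ⟨⟨N, hNo⟩, hxN, ⟨j, fun y hy => (hN hy).1⟩, fun l W hW hWN hWL => ?_⟩
  by_cases hne : ∃ y, y ∈ W
  · obtain ⟨y, hy⟩ := hne
    have hl : ∀ k f, l k f ∈ T k f := fun k f =>
      (hN (hWN hy)).2.2 ⟨k, f⟩ _ (hWL y hy k f)
    obtain ⟨hVU, t, ht⟩ := hV l hl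
    have hWV : W ≤ V l := fun z hz => (hN (hWN hz)).2.1 l hl
    refine ⟨(F.sec n).map (homOfLE hWV).op t, ?_⟩
    rw [app_map_apply, ht]
    exact map_map_apply hVU hWV hW _
  · exact ⟨0, eq_of_isSheaf_of_empty (hF'' n) (fun y hy => hne ⟨y, hy⟩) _ _⟩

lemma LocallySurjective.exists_lift (hφ : LocallySurjective φ) (hF'' : F''.IsRealSheaf)
    (hT2 : ∀ n, T2Space (X.space n)) (hX : ∀ n, ParacompactSpace (X.space n)) (𝒰 : RealCover X)
    (n : ℕ) (c : cochain 𝒰.nat F'' n) :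
    ∃ (𝒱 : RealCover X) (r : Refinement 𝒰 𝒱) (b : cochain 𝒱.nat F n),
      φ.cochainMap 𝒱.nat n b = r.nat.cochainMap F'' n c := by
  choose L hLc hLf hLU hLinv hLx using fun n => 𝒰.exists_closed_shrinking n
  -- A cover needs neighbourhoods at every level, but only level `n` carries a cochain to lift;
  -- `Pi.single` puts zero at the others.
  choose A hxA hAL hA using fun (m : ℕ) (x : X.space m) =>
    hφ.exists_nhd hF'' hLc hLf hLU hLx (Pi.single (M := fun m => cochain 𝒰.nat F'' m) n c m) x
  choose θ hθ using hAL
  let 𝒱 := RealCover.double (fun m => X.space m) A fun m x => ⟨x, hxA m x⟩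
  let r : Refinement 𝒰 𝒱 := RealCover.doubleRefinement θ fun m x => (hθ m x).trans (hLU m _)
  -- Conjugate members are included because the family `L` is Real.
  have hr : ∀ m (j : 𝒱.J m) (y : X.space m), y ∈ 𝒱.U m j → y ∈ L m (r.θ m j) := by
    rintro m ⟨x, _ | _⟩ y hy
    · have h := hLinv m _ _ (hθ m x hy)
      rwa [X.inv_inv] at h
    · exact hθ m x hy
  refine ⟨𝒱, r, exists_lift_of_sign φ (𝒱 := 𝒱) Prod.snd (fun _ => rfl)
    (r.nat.cochainMap F'' n c) fun l hl => ?_⟩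
  have h := hA n (l n (Inc.id n)).1 (r.nat.θ n l) (𝒱.natU n l) (r.nat.le n l) (fun y hy => ?_)
    fun y hy k f => hr k _ _ (hy k f)
  · rw [Pi.single_eq_same] at h
    exact h
  -- The sign is `true`, so the identity component confines `y` to the chosen neighbourhood itself
  -- and not to its conjugate.
  · have hy' := hy n (Inc.id n)
    change X.face (𝟙 _) y ∈ (if (l n (Inc.id n)).2 = true then A n _ else _) at hy'
    rwa [X.face_id, if_pos hl] at hy'

end sheaf

lemma SheafShortExact.cechShortExact {F' F F'' : RealPresheaf X} {φ' : F'.Hom F}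
    {φ : F.Hom F''} (hT2 : ∀ n, T2Space (X.space n)) (hX : ∀ n, ParacompactSpace (X.space n))
    (hF' : F'.IsRealSheaf) (hF : F.IsRealSheaf) (hF'' : F''.IsRealSheaf)
    (h : SheafShortExact φ' φ) : CechShortExact φ' φ := by
  have hinj : ∀ n (U : Opens (X.space n)), Function.Injective ((φ'.app n).app (op U)) :=
    fun n U => TopCat.Presheaf.app_injective_of_stalkFunctor_map_injective
      (F := (⟨F'.sec n, hF' n⟩ : TopCat.Sheaf _ _)) (φ'.app n) U fun x _ => (h n x).1
  have hsurj : LocallySurjective φ := fun n U s x hx =>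
    exists_local_lift (φ.app n) hx s ((h n x).2.2 _)
  exact ⟨hinj, fun n => exact_app_of_exact_stalk (hF' n) (hF n) (hF'' n) _ _ (hinj n)
    fun x => (h n x).2.1, hsurj.exists_lift hF'' hT2 hX⟩

end RealCech
end

/-! ### Assembly of the long exact sequence -/

open RealCech in
theorem mainTheorem9 (X : RealSimplicialSpace.{u})
    (hT2 : ∀ n, T2Space (X.space n)) (hX : ∀ n, ParacompactSpace (X.space n))
    (F' F F'' : RealPresheaf X) (φ' : F'.Hom F) (φ : F.Hom F'')
    (hexact : PresheafShortExact φ' φ ∨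
      (F'.IsRealSheaf ∧ F.IsRealSheaf ∧ F''.IsRealSheaf ∧ SheafShortExact φ' φ)) :
    ∃ bd : ∀ n, CechHR F'' n →+ CechHR F' (n + 1),
      Function.Injective (φ'.mapCech 0) ∧
      (∀ n, Function.Exact (φ'.mapCech n) (φ.mapCech n)) ∧
      (∀ n, Function.Exact (φ.mapCech n) (bd n)) ∧
      (∀ n, Function.Exact (bd n) (φ'.mapCech (n + 1))) ∧
      (∀ (n : ℕ) (𝒰 : RealCover X) (h : 𝒰.IsAdmissible n) (h' : 𝒰.IsAdmissible (n + 1))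
        (c : cochain 𝒰.nat F n) (z : cocycle 𝒰.nat F'' n) (z' : cocycle 𝒰.nat F' (n + 1)),
        φ.cochainMap 𝒰.nat n c = z.1 →
        φ'.cochainMap 𝒰.nat (n + 1) z'.1 = d 𝒰.nat F n c →
        bd n (CechHR.cls ⟨𝒰, h⟩ z) = CechHR.cls ⟨𝒰, h'⟩ z') := by
  have H : CechShortExact φ' φ := by
    rcases hexact with h | ⟨hF', hF, hF'', h⟩
    · exact h.cechShortExact
    · exact h.cechShortExact hT2 hX hF' hF hF''
  choose bd hbd using H.exists_connecting
  refine ⟨bd, H.mapCech_zero_injective, fun n => H.mapCech_exact, fun n x => ?_, fun n y => ?_, ?_⟩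
  · rw [hbd, H.isConnecting_zero_iff]
  · simp only [← H.exists_isConnecting_iff, Set.mem_range, hbd]
  · intro n 𝒰 h h' c z z' hz hz'
    exact (hbd n _ _).2 ⟨𝒰, h, h', c, z, z', hz, hz', rfl, rfl⟩
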